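/- Let $M,N_{\rm S},N_{\rm EH},N_{\rm ID}\ge 1$ be integers with $M,N_{\rm S}>1$, let $\mathbf H_{\rm EH}\in\mathbb C^{N_{\rm EH}\times M}$, $\mathbf H_{\rm ID}\in\mathbb C^{N_{\rm ID}\times M}$, $\theta\in\mathbb R$, $\alpha\in\mathbb C\setminus\{0\}$, $L\in\{1,2,\dots\}$, $\sigma_{\rm S},\sigma_{\rm ID},\Gamma_{\rm S}>0$ and $P,\Gamma_{\rm EH}\in\mathbb R$. Let $\mathbf A=\mathbf A(\theta)=\mathbf a_r(\theta)\mathbf a_t(\theta)^T\in\mathbb C^{N_{\rm S}\times M}$ and $\dot{\mathbf A}=\partial\mathbf A(\theta)/\partial\theta$, where for the array with $N$ antennas ($N=M$ for $\mathbf a_t$, $N=N_{\rm S}$ for $\mathbf a_r$) the steering vector has entries $e^{-j\frac{N-1-2m}{2}\pi\sin\theta}$, $m=0,\dots,N-1$. Write $\dagger$ for complex conjugation, $(x)^+=\max(x,0)$, and for $\mathbf S\succeq\mathbf 0$ in $\mathbb C^{M\times M}$ put $$\mathrm{CRB}(\mathbf S)=\frac{\sigma_{\rm S}^2}{2|\alpha|^2L}\,\frac{\mathrm{tr}(\mathbf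 A^H\mathbf A\mathbf S)}{\mathrm{tr}(\dot{\mathbf A}^H\dot{\mathbf A}\mathbf S)\,\mathrm{tr}(\mathbf A^H\mathbf A\mathbf S)-|\mathrm{tr}(\dot{\mathbf A}^H\mathbf A\mathbf S)|^2}\in[0,\infty],$$ with value $\infty$ if only the denominator vanishes, and $\mathrm{CRB}(\mathbf S)=\frac{\sigma_{\rm S}^2}{2|\alpha|^2L}\cdot\frac1{\mathrm{tr}(\dot{\mathbf A}^H\dot{\mathbf A}\mathbf S)}$ (with $1/0=\infty$) if $\mathrm{tr}(\mathbf A^H\mathbf A\mathbf S)=0$, where the quotient is $0/0$. Consider $$\text{(P1)}\quad\max_{\mathbf S\succeq\mathbf 0}\ R(\mathbf S)=\log_2\det\Big(\mathbf I+\tfrac1{\sigma_{\rm ID}^2}\mathbf H_{\rm ID}\mathbf S\mathbf H_{\rm ID}^H\Big)\quad\text{s.t.}\quad \mathrm{tr}(\mathbf H_{\rm EH}\mathbf S\mathbf H_{\rm EH}^H)\ge\Gamma_{\rm EH},\ \ \mathrm{CRB}(\mathbf S)\le\Gamma_{\rm S},\ \ \mathrm{tr}(\mathbf S)\le P .$$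 With $\Gamma_{{\rm S},1}=\frac{2|\alpha|^2L}{\sigma_{\rm S}^2}\Gamma_{\rm S}$, the CRB constraint is reformulated as $$\mathbf M(\mathbf S)=\begin{bmatrix}\mathrm{tr}(\dot{\mathbf A}^H\dot{\mathbf A}\mathbf S)-\frac1{\Gamma_{{\rm S},1}}&\mathrm{tr}(\dot{\mathbf A}^H\mathbf A\mathbf S)^\dagger\\ \mathrm{tr}(\dot{\mathbf A}^H\mathbf A\mathbf S)&\mathrm{tr}(\mathbf A^H\mathbf A\mathbf S)\end{bmatrix}\succeq\mathbf 0 .$$ Assume that Slater's condition holds: some $\mathbf S\succeq\mathbf 0$ satisfies $\mathrm{tr}(\mathbf H_{\rm EH}\mathbf S\mathbf H_{\rm EH}^H)>\Gamma_{\rm EH}$, $\mathrm{tr}(\mathbf S)<P$ and $\mathbf M(\mathbf S)\succ\mathbf 0$. For $\lambda,\nu\in\mathbb R$ and $\mathbf Z=\begin{bmatrix}z_1&z_2\\z_2^\dagger&z_3\end{bmatrix}$ let $\mathbf D=\nu\mathbf I_M-\lambda\mathbf H_{\rm EH}^H\mathbf H_{\rm EH}-z_1\dot{\mathbf A}^H\dot{\mathbf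 A}-z_2\dot{\mathbf A}^H\mathbf A-z_2^\dagger\mathbf A^H\dot{\mathbf A}-z_3\mathbf A^H\mathbf A$ and $g(\lambda,\nu,\mathbf Z)=\sup_{\mathbf S\succeq\mathbf 0}\big(R(\mathbf S)-\mathrm{tr}(\mathbf D\mathbf S)-\lambda\Gamma_{\rm EH}+\nu P-z_1/\Gamma_{{\rm S},1}\big)$. The dual problem (D1) is to minimize $g$ over $\lambda\ge0$, $\nu\ge0$, $\mathbf Z\succeq\mathbf 0$ subject to $\mathbf D\succeq\mathbf 0$ and $\mathcal R(\mathbf H_{\rm ID}^H)\subseteq\mathcal R(\mathbf D)$, where $\mathcal R$ denotes the range. Then (D1) has an optimal solution. Let $(\lambda^*,\nu^*,\mathbf Z^*)$ be any optimal solution of (D1), $\mathbf D$ the corresponding matrix, $r=\mathrm{rank}(\mathbf D)$, and let $$\mathbf D=[\mathbf Q^{\overline{\rm null}}\ \mathbf Q^{\rm null}]\begin{bmatrix}\mathbf\Sigma&\mathbf 0\\\mathbf 0&\mathbf 0\end{bmatrix}[\mathbf Q^{\overline{\rm null}}\ \mathbf Q^{\rm null}]^H,\qquad \mathbf H_{\rm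 ID}\mathbf Q^{\overline{\rm null}}\mathbf\Sigma^{-1/2}=\mathbf U_{\rm p}\mathbf\Lambda_{\rm p}\mathbf V_{\rm p}^H$$ be any eigenvalue decomposition of $\mathbf D$ ($[\mathbf Q^{\overline{\rm null}}\ \mathbf Q^{\rm null}]$ unitary, $\mathbf\Sigma$ the $r\times r$ diagonal matrix of the non-zero eigenvalues) and any singular value decomposition, with positive singular values $\lambda_{{\rm p},1},\dots,\lambda_{{\rm p},\tilde r}$ in the first $\tilde r$ diagonal positions of $\mathbf\Lambda_{\rm p}$, where $\tilde r=\mathrm{rank}(\mathbf H_{\rm ID}\mathbf Q^{\overline{\rm null}}\mathbf\Sigma^{-1/2})$. Put $$\mathbf S_{11}^{\rm opt}=\mathbf\Sigma^{-1/2}\mathbf V_{\rm p}\,\mathrm{diag}(\tilde p_1,\dots,\tilde p_{\tilde r},0,\dots,0)\,\mathbf V_{\rm p}^H\mathbf\Sigma^{-1/2},\qquad \tilde p_k=\Big(\frac1{\ln2}-\frac{\sigma_{\rm ID}^2}{\lambda_{{\rm p},k}^2}\Big)^+ .$$ Then the convex feasibility problem of finding $\mathbf S_{10}\in\mathbb C^{r\times(M-r)}$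 and $\mathbf S_{00}\in\mathbb C^{(M-r)\times(M-r)}$ such that $$\mathbf S=[\mathbf Q^{\overline{\rm null}}\ \mathbf Q^{\rm null}]\begin{bmatrix}\mathbf S_{11}^{\rm opt}&\mathbf S_{10}\\\mathbf S_{10}^H&\mathbf S_{00}\end{bmatrix}[\mathbf Q^{\overline{\rm null}}\ \mathbf Q^{\rm null}]^H$$ satisfies $\mathbf S\succeq\mathbf 0$, $\mathrm{tr}(\mathbf H_{\rm EH}\mathbf S\mathbf H_{\rm EH}^H)\ge\Gamma_{\rm EH}$, $\mathrm{tr}(\mathbf S)\le P$ and $\mathbf M(\mathbf S)\succeq\mathbf 0$ has a solution, and the optimal solutions of (P1) are exactly the matrices $\mathbf S$ obtained from its solutions $(\mathbf S_{10},\mathbf S_{00})$. -/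

import Mathlib

open Matrix
open scoped ENNReal ComplexOrder

noncomputable section

namespace MultiFunMIMO

/-- Steering vector of a uniform linear array with `N` antennas at half-wavelength spacing and
reference point at the centre: entry `m = 0, …, N - 1` is `exp (-j ((N - 1 - 2 m) / 2) π sin θ)`. -/
def steering (N : ℕ) (θ : ℝ) : Fin N → ℂ := fun m =>
  Complex.exp (-(Complex.I * ((((((N : ℝ) - 1 - 2 * (m : ℕ)) / 2) * Real.pi * Real.sin θ : ℝ)) : ℂ)))

/-- The response matrix `A(θ) = a_r(θ) a_t(θ)ᵀ`. -/
def arrayResponse (NS M : ℕ) (θ : ℝ) : Matrix (Fin NS) (Fin M) ℂ :=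
  Matrix.vecMulVec (steering NS θ) (steering M θ)

/-- The entrywise derivative `∂A(θ)/∂θ`. -/
def arrayResponseDeriv (NS M : ℕ) (θ : ℝ) : Matrix (Fin NS) (Fin M) ℂ :=
  Matrix.of fun i k => deriv (fun t : ℝ => arrayResponse NS M t i k) θ

/-- Data of the multi-functional MIMO system: `M` transmit antennas and `NS` sensing receive
antennas at the access point, `NEH` and `NID` antennas at the two receivers. -/
structure SystemModel (M NS NEH NID : ℕ) where
  /-- channel to the energy-harvesting receiver -/
  HEH : Matrix (Fin NEH) (Fin M) ℂ
  /-- channel to the information-decoding receiver -/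
  HID : Matrix (Fin NID) (Fin M) ℂ
  /-- target angle -/
  θ : ℝ
  /-- complex reflection coefficient -/
  α : ℂ
  /-- number of symbols in the block -/
  L : ℕ
  /-- sensing noise standard deviation -/
  σS : ℝ
  /-- noise standard deviation at the information receiver -/
  σID : ℝ
  /-- power budget -/
  P : ℝ
  /-- required harvested energy -/
  ΓEH : ℝ
  /-- largest admissible Cramér–Rao bound -/
  ΓS : ℝ

namespace SystemModel

variable {M NS NEH NID : ℕ} (sys : SystemModel M NS NEH NID)

/-- `A = A(θ)` -/
def A : Matrix (Fin NS) (Fin M) ℂ := arrayResponse NS M sys.θ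

/-- `Ȧ = ∂A(θ)/∂θ` -/
def dA : Matrix (Fin NS) (Fin M) ℂ := arrayResponseDeriv NS M sys.θ

/-- Achievable rate `log₂ det (I + σ_ID⁻² H_ID S H_IDᴴ)`; the determinant is real for `S ⪰ 0`. -/
def rate (S : Matrix (Fin M) (Fin M) ℂ) : ℝ :=
  Real.logb 2
    (1 + ((1 / sys.σID ^ 2 : ℝ) : ℂ) • (sys.HID * S * sys.HIDᴴ)).det.re

/-- Harvested energy `tr (H_EH S H_EHᴴ)`. -/
def energy (S : Matrix (Fin M) (Fin M) ℂ) : ℝ := (sys.HEH * S * sys.HEHᴴ).trace.re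

/-- The constant `σ_S² / (2 |α|² L)`. -/
def crbConst : ℝ := sys.σS ^ 2 / (2 * ‖sys.α‖ ^ 2 * sys.L)

/-- The Cramér–Rao bound for `θ`, with values in `[0, ∞]`:
`crbConst * tr(AᴴAS) / (tr(ȦᴴȦS) tr(AᴴAS) - |tr(ȦᴴAS)|²)`, which is `∞` when only the denominator
vanishes. If `tr(AᴴAS) = 0`, then (for `S ⪰ 0`) `tr(ȦᴴAS) = 0` too, the Fisher information
carries no coupling between `θ` and the reflection coefficient, the quotient reads `0 / 0`, and
the bound is the inverse `crbConst / tr(ȦᴴȦS)` of the Fisher information of `θ`. -/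
def crb (S : Matrix (Fin M) (Fin M) ℂ) : ℝ≥0∞ :=
  if (sys.Aᴴ * sys.A * S).trace.re = 0 then
    ENNReal.ofReal sys.crbConst / ENNReal.ofReal (sys.dAᴴ * sys.dA * S).trace.re
  else
    ENNReal.ofReal (sys.crbConst * (sys.Aᴴ * sys.A * S).trace.re) /
      ENNReal.ofReal ((sys.dAᴴ * sys.dA * S).trace.re * (sys.Aᴴ * sys.A * S).trace.re
        - ‖(sys.dAᴴ * sys.A * S).trace‖ ^ 2)

/-- Feasible set of the rate maximization problem. -/
def feasibleSet : Set (Matrix (Fin M) (Fin M) ℂ) :=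
  {S | S.PosSemidef ∧ sys.ΓEH ≤ sys.energy S ∧ sys.crb S ≤ ENNReal.ofReal sys.ΓS ∧
    S.trace.re ≤ sys.P}

/-- `S` is an optimal solution of the rate maximization problem. -/
def IsOptimal (S : Matrix (Fin M) (Fin M) ℂ) : Prop :=
  S ∈ sys.feasibleSet ∧ IsMaxOn sys.rate sys.feasibleSet S

/-- `Γ_{S,1} = (2 |α|² L / σ_S²) Γ_S` -/
def ΓS1 : ℝ := 2 * ‖sys.α‖ ^ 2 * sys.L / sys.σS ^ 2 * sys.ΓS

/-- The `2 × 2` matrix whose positive semidefiniteness reformulates the bound on the CRB. -/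
def crbMatrix (S : Matrix (Fin M) (Fin M) ℂ) : Matrix (Fin 2) (Fin 2) ℂ :=
  !![(sys.dAᴴ * sys.dA * S).trace - ((1 / sys.ΓS1 : ℝ) : ℂ), star (sys.dAᴴ * sys.A * S).trace;
     (sys.dAᴴ * sys.A * S).trace, (sys.Aᴴ * sys.A * S).trace]

/-- Slater's condition for the reformulated convex problem: some `S ⪰ 0` satisfies the energy
constraint, the power constraint and the `2 × 2` matrix constraint strictly. -/
def Slater : Prop :=
  ∃ S : Matrix (Fin M) (Fin M) ℂ, S.PosSemidef ∧ sys.ΓEH < sys.energy S ∧ S.trace.re < sys.P ∧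
    (sys.crbMatrix S).PosDef

/-- The composite matrix
`D = ν I - λ H_EHᴴ H_EH - z₁ ȦᴴȦ - z₂ ȦᴴA - z₂† AᴴȦ - z₃ AᴴA`, `Z = [[z₁, z₂], [z₂†, z₃]]`. -/
def D (lam nu : ℝ) (Z : Matrix (Fin 2) (Fin 2) ℂ) : Matrix (Fin M) (Fin M) ℂ :=
  (nu : ℂ) • (1 : Matrix (Fin M) (Fin M) ℂ) - (lam : ℂ) • (sys.HEHᴴ * sys.HEH)
    - Z 0 0 • (sys.dAᴴ * sys.dA) - Z 0 1 • (sys.dAᴴ * sys.A)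
    - star (Z 0 1) • (sys.Aᴴ * sys.dA) - Z 1 1 • (sys.Aᴴ * sys.A)

/-- The Lagrangian. -/
def lagrangian (S : Matrix (Fin M) (Fin M) ℂ) (lam nu : ℝ) (Z : Matrix (Fin 2) (Fin 2) ℂ) : ℝ :=
  sys.rate S - (sys.D lam nu Z * S).trace.re - lam * sys.ΓEH + nu * sys.P
    - (Z 0 0).re / sys.ΓS1

/-- The dual function: supremum of the Lagrangian over `S ⪰ 0`, possibly `+∞`. -/
def dualFun (lam nu : ℝ) (Z : Matrix (Fin 2) (Fin 2) ℂ) : EReal :=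
  ⨆ S : {S : Matrix (Fin M) (Fin M) ℂ // S.PosSemidef},
    ((sys.lagrangian S.1 lam nu Z : ℝ) : EReal)

/-- Constraints of the dual problem: `λ, ν ≥ 0`, `Z ⪰ 0`, `D ⪰ 0`, `range H_IDᴴ ⊆ range D`. -/
structure IsDualFeasible (lam nu : ℝ) (Z : Matrix (Fin 2) (Fin 2) ℂ) : Prop where
  lam_nonneg : 0 ≤ lam
  nu_nonneg : 0 ≤ nu
  Z_posSemidef : Z.PosSemidef
  D_posSemidef : (sys.D lam nu Z).PosSemidef
  range_le : LinearMap.range sys.HIDᴴ.mulVecLin ≤ LinearMap.range (sys.D lam nu Z).mulVecLin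

/-- `(λ, ν, Z)` is an optimal solution of the dual problem. -/
def IsDualOptimal (lam nu : ℝ) (Z : Matrix (Fin 2) (Fin 2) ℂ) : Prop :=
  sys.IsDualFeasible lam nu Z ∧
    ∀ lam' nu' Z', sys.IsDualFeasible lam' nu' Z' → sys.dualFun lam nu Z ≤ sys.dualFun lam' nu' Z'

end SystemModel

/-- The block row `[Q₁ Q₀]`. -/
def joinCols {M r : ℕ} (Q₁ : Matrix (Fin M) (Fin r) ℂ) (Q₀ : Matrix (Fin M) (Fin (M - r)) ℂ) :
    Matrix (Fin M) (Fin r ⊕ Fin (M - r)) ℂ :=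
  Matrix.fromCols Q₁ Q₀

/-- Eigenvalue decomposition `D = [Q₁ Q₀] [[diag σ, 0], [0, 0]] [Q₁ Q₀]ᴴ` with `[Q₁ Q₀]` unitary
and `σ` listing the `r = rank D` non-zero eigenvalues. -/
structure IsEVD {M : ℕ} (D : Matrix (Fin M) (Fin M) ℂ) (r : ℕ)
    (Q₁ : Matrix (Fin M) (Fin r) ℂ) (Q₀ : Matrix (Fin M) (Fin (M - r)) ℂ) (σ : Fin r → ℝ) :
    Prop where
  rank_eq : D.rank = r
  orthonormal : (joinCols Q₁ Q₀)ᴴ * joinCols Q₁ Q₀ = 1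
  complete : joinCols Q₁ Q₀ * (joinCols Q₁ Q₀)ᴴ = 1
  ne_zero : ∀ k, σ k ≠ 0
  eq : D = joinCols Q₁ Q₀ *
    fromBlocks (diagonal fun k => (σ k : ℂ)) (0 : Matrix (Fin r) (Fin (M - r)) ℂ)
      (0 : Matrix (Fin (M - r)) (Fin r) ℂ) (0 : Matrix (Fin (M - r)) (Fin (M - r)) ℂ) *
    (joinCols Q₁ Q₀)ᴴ

/-- The rectangular diagonal matrix with diagonal entries `s`. -/
def rectDiagonal {r : ℕ} (N : ℕ) (s : Fin r → ℝ) : Matrix (Fin N) (Fin r) ℂ :=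
  Matrix.of fun i k => if (i : ℕ) = (k : ℕ) then (s k : ℂ) else 0

/-- Singular value decomposition `G = U Λ Vᴴ` with `U`, `V` unitary and `Λ` rectangular diagonal,
whose first `rt = rank G` diagonal entries are positive and whose other entries are zero. -/
structure IsSVD {N r : ℕ} (G : Matrix (Fin N) (Fin r) ℂ) (rt : ℕ)
    (U : Matrix (Fin N) (Fin N) ℂ) (s : Fin r → ℝ) (V : Matrix (Fin r) (Fin r) ℂ) : Prop where
  rank_eq : G.rank = rt
  U_mem : U ∈ Matrix.unitaryGroup (Fin N) ℂ
  V_mem : V ∈ Matrix.unitaryGroup (Fin r) ℂ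
  pos : ∀ k : Fin r, (k : ℕ) < rt → 0 < s k
  eq_zero : ∀ k : Fin r, rt ≤ (k : ℕ) → s k = 0
  eq : G = U * rectDiagonal N s * Vᴴ

/-- `Σ^{-1/2}` for `Σ = diag σ`, `σ > 0`. -/
def invSqrtDiag {r : ℕ} (σ : Fin r → ℝ) : Matrix (Fin r) (Fin r) ℂ :=
  diagonal fun k => (((Real.sqrt (σ k))⁻¹ : ℝ) : ℂ)

/-- Water-filling powers: `(1 / ln 2 - σ_ID² / s_k²)⁺` for the first `rt` indices, then zero. -/
def waterFilling {r : ℕ} (σID : ℝ) (rt : ℕ) (s : Fin r → ℝ) : Fin r → ℝ := fun k =>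
  if (k : ℕ) < rt then max (1 / Real.log 2 - σID ^ 2 / s k ^ 2) 0 else 0

/-- `S₁₁ = Σ^{-1/2} V diag(p̃₁, …, p̃_rt, 0, …, 0) Vᴴ Σ^{-1/2}`. -/
def optS11 {r : ℕ} (σID : ℝ) (σ : Fin r → ℝ) (rt : ℕ) (s : Fin r → ℝ)
    (V : Matrix (Fin r) (Fin r) ℂ) : Matrix (Fin r) (Fin r) ℂ :=
  invSqrtDiag σ * V * (diagonal fun k => (waterFilling σID rt s k : ℂ)) * Vᴴ * invSqrtDiag σ

/-- `[Q₁ Q₀] [[S₁₁, S₁₀], [S₁₀ᴴ, S₀₀]] [Q₁ Q₀]ᴴ`. -/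
def assemble {M r : ℕ} (Q₁ : Matrix (Fin M) (Fin r) ℂ) (Q₀ : Matrix (Fin M) (Fin (M - r)) ℂ)
    (S₁₁ : Matrix (Fin r) (Fin r) ℂ) (S₁₀ : Matrix (Fin r) (Fin (M - r)) ℂ)
    (S₀₀ : Matrix (Fin (M - r)) (Fin (M - r)) ℂ) : Matrix (Fin M) (Fin M) ℂ :=
  joinCols Q₁ Q₀ * fromBlocks S₁₁ S₁₀ S₁₀ᴴ S₀₀ * (joinCols Q₁ Q₀)ᴴ

/-- Constraints of the remaining convex feasibility problem, for a covariance `S`: `S ⪰ 0`,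
the energy constraint, the power constraint and the `2 × 2` matrix constraint. -/
structure SystemModel.SatisfiesConvexConstraints {M NS NEH NID : ℕ}
    (sys : SystemModel M NS NEH NID) (S : Matrix (Fin M) (Fin M) ℂ) : Prop where
  posSemidef : S.PosSemidef
  energy_ge : sys.ΓEH ≤ sys.energy S
  power_le : S.trace.re ≤ sys.P
  crbMatrix_posSemidef : (sys.crbMatrix S).PosSemidef

end MultiFunMIMO

end

/-! The proof is strong duality followed by uniqueness of water filling. The feasible set is compact
and the rate continuous, so a primal optimum `S` exists. The rate is concave and Slater's condition
holds, so separation (`ConcaveOn.exists_lagrange_multiplier`) yields multipliers whose Lagrangian is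
at most `R(S)` on the whole cone. A Lagrangian bounded above forces `D ⪰ 0` and the range inclusion
(`isDualFeasible_of_bddAbove`), so these multipliers are dual feasible, and by weak duality they are
dual optimal. Hence for every dual optimum and every primal optimum `S`, `L(T) ≤ R(S) ≤ L(S)` for
all `T ⪰ 0`: `S` maximizes `R(S) - tr(DS)`.

The range inclusion gives `H_ID Q₀ = 0`, so with `T = Vᴴ Σ^{1/2} Q₁ᴴ` (`exists_whitening`) this
objective depends on `X = T S Tᴴ` alone and becomes `log₂ det(I + σ⁻² G X Gᴴ) - tr X` with `Gᴴ G`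
diagonal. Its only maximizer is the water-filling matrix (`waterFilling_isMax`), which fixes the
block `Q₁ᴴ S Q₁` of every primal optimum. Conversely the rate depends on that block alone, so every
feasible completion of it is optimal. -/

namespace Matrix

/-! ### Positive semidefinite matrices and the concavity of `log det`. -/

theorem PosSemidef.exists_eq_conjTranspose_mul_self {n : Type*} [Fintype n]
    {A : Matrix n n ℂ} (hA : A.PosSemidef) : ∃ B : Matrix n n ℂ, A = Bᴴ * B := by
  classical
  open scoped MatrixOrder in
  obtain ⟨B, hB⟩ := CStarAlgebra.nonneg_iff_eq_star_mul_self.mp hA.nonneg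
  exact ⟨B, hB⟩

theorem PosSemidef.trace_mul_nonneg {n : Type*} [Fintype n] {A B : Matrix n n ℂ}
    (hA : A.PosSemidef) (hB : B.PosSemidef) : 0 ≤ (A * B).trace := by
  obtain ⟨C, rfl⟩ := hA.exists_eq_conjTranspose_mul_self
  rw [Matrix.mul_assoc, trace_mul_comm]
  exact (hB.mul_mul_conjTranspose_same C).trace_nonneg

theorem PosSemidef.eq_zero_of_diag_eq_zero {n : Type*} [Fintype n] {A : Matrix n n ℂ}
    (hA : A.PosSemidef) {k : n} (hk : A k k = 0) (l : n) : A k l = 0 := by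
  obtain ⟨C, rfl⟩ := hA.exists_eq_conjTranspose_mul_self
  have h : star (fun i => C i k) ⬝ᵥ (fun i => C i k) = 0 := hk
  rw [dotProduct_star_self_eq_zero] at h
  simp only [mul_apply, conjTranspose_apply]
  exact Finset.sum_eq_zero fun i _ => by rw [congrFun h i]; simp

/-- Entries are inner products of columns of a Gram factor, and the trace is the sum of the squared
column norms. This bounds the feasible set. -/
theorem PosSemidef.norm_apply_le_trace {n : Type*} [Fintype n] {A : Matrix n n ℂ}
    (hA : A.PosSemidef) (i j : n) : ‖A i j‖ ≤ A.trace.re := by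
  obtain ⟨C, rfl⟩ := hA.exists_eq_conjTranspose_mul_self
  have htr : (Cᴴ * C).trace.re = ∑ a, ∑ b, ‖C b a‖ ^ 2 := by
    simp only [trace, diag_apply, mul_apply, conjTranspose_apply, Complex.re_sum]
    refine Finset.sum_congr rfl fun a _ => Finset.sum_congr rfl fun b _ => ?_
    rw [Complex.star_def, ← Complex.normSq_eq_conj_mul_self, Complex.ofReal_re,
      Complex.normSq_eq_norm_sq]
  have hcol (k : n) : ∑ b, ‖C b k‖ ^ 2 ≤ (Cᴴ * C).trace.re := by
    rw [htr]
    exact Finset.single_le_sum (f := fun a => ∑ b, ‖C b a‖ ^ 2)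
      (fun a _ => Finset.sum_nonneg fun b _ => sq_nonneg _) (Finset.mem_univ k)
  have h1 : ‖(Cᴴ * C) i j‖ ≤ ∑ b, ‖C b i‖ * ‖C b j‖ := by
    rw [mul_apply]
    refine (norm_sum_le _ _).trans (Finset.sum_le_sum fun b _ => ?_)
    simp
  have h2 : ∑ b, ‖C b i‖ * ‖C b j‖ ≤ (∑ b, ‖C b i‖ ^ 2 + ∑ b, ‖C b j‖ ^ 2) / 2 := by
    rw [← Finset.sum_add_distrib, Finset.sum_div]
    exact Finset.sum_le_sum fun b _ => by nlinarith [sq_nonneg (‖C b i‖ - ‖C b j‖)]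
  linarith [hcol i, hcol j]

theorem PosDef.det_re_pos {n : Type*} [Fintype n] [DecidableEq n] {A : Matrix n n ℂ}
    (hA : A.PosDef) : 0 < A.det.re := (Complex.pos_iff.mp hA.det_pos).1

theorem PosDef.ofReal_det_re {n : Type*} [Fintype n] [DecidableEq n] {A : Matrix n n ℂ}
    (hA : A.PosDef) : ((A.det.re : ℝ) : ℂ) = A.det :=
  Complex.ext rfl (Complex.pos_iff.mp hA.det_pos).2

/-- Sum `log μ ≤ μ - 1` over the eigenvalues; equality holds only at `μ = 1`. -/
theorem PosDef.log_det_re_le {n : Type*} [Fintype n] [DecidableEq n] {A : Matrix n n ℂ}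
    (hA : A.PosDef) :
    Real.log A.det.re ≤ (A - 1).trace.re ∧ (Real.log A.det.re = (A - 1).trace.re → A = 1) := by
  set μ := hA.1.eigenvalues with hμ
  have hpos : ∀ i, 0 < μ i := hA.eigenvalues_pos
  have hdet : A.det.re = ∏ i, μ i := by
    rw [hA.1.det_eq_prod_eigenvalues]
    norm_cast
  have htr : (A - 1).trace.re = ∑ i, (μ i - 1) := by
    rw [trace_sub, hA.1.trace_eq_sum_eigenvalues, Finset.sum_sub_distrib]
    simp [hμ]
  rw [hdet, htr, Real.log_prod fun i _ => (hpos i).ne']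
  have hle : ∀ i ∈ Finset.univ, Real.log (μ i) ≤ μ i - 1 := fun i _ =>
    Real.log_le_sub_one_of_pos (hpos i)
  refine ⟨Finset.sum_le_sum hle, fun h => ?_⟩
  have h1 : μ = fun _ => 1 := by
    funext i
    by_contra hne
    exact (Real.log_lt_sub_one_of_pos (hpos i) hne).ne
      ((Finset.sum_eq_sum_iff_of_le hle).mp h i (Finset.mem_univ i))
  rw [hA.1.spectral_theorem, ← hμ, h1]
  have : diagonal ((RCLike.ofReal : ℝ → ℂ) ∘ fun _ : n => (1 : ℝ)) = 1 := by
    ext i j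
    simp [diagonal_apply, one_apply]
  rw [this, map_one]

/-- The tangent plane inequality for the concave function `log det`, with its equality case. -/
theorem PosDef.log_det_re_le_tangent {n : Type*} [Fintype n] [DecidableEq n]
    {A B : Matrix n n ℂ} (hA : A.PosDef) (hB : B.PosDef) :
    Real.log B.det.re ≤ Real.log A.det.re + (A⁻¹ * (B - A)).trace.re ∧
      (Real.log B.det.re = Real.log A.det.re + (A⁻¹ * (B - A)).trace.re → B = A) := by
  obtain ⟨C, hC⟩ := hA.posSemidef.exists_eq_conjTranspose_mul_self
  have hCu : IsUnit C.det := by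
    have := hA.isUnit
    rw [Matrix.isUnit_iff_isUnit_det, hC, det_mul] at this
    exact isUnit_of_mul_isUnit_right this
  have hCHu : IsUnit Cᴴ.det := by rw [det_conjTranspose]; exact hCu.star
  -- The congruence that takes `A = Cᴴ C` to `1` reduces the claim to `log_det_re_le` for `E`.
  set E := (C⁻¹)ᴴ * B * C⁻¹ with hE
  have hEpos : E.PosDef := by
    refine hB.conjTranspose_mul_mul_same ?_
    exact Matrix.mulVec_injective_of_isUnit (by rw [isUnit_nonsing_inv_iff, Matrix.isUnit_iff_isUnit_det]; exact hCu)
  have hBE : B = Cᴴ * E * C := by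
    rw [hE, conjTranspose_nonsing_inv, Matrix.mul_assoc, Matrix.mul_assoc, Matrix.mul_assoc,
      nonsing_inv_mul _ hCu, Matrix.mul_one, ← Matrix.mul_assoc, mul_nonsing_inv _ hCHu,
      Matrix.one_mul]
  have hdet : B.det.re = A.det.re * E.det.re := by
    have : B.det = A.det * E.det := by
      rw [hBE, hC]; simp only [det_mul]; ring
    rw [← hA.ofReal_det_re, ← hEpos.ofReal_det_re] at this
    rw [this]
    norm_cast
  have htr : (A⁻¹ * (B - A)).trace = (E - 1).trace := by
    have : B - A = Cᴴ * (E - 1) * C := by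
      rw [hBE, hC, Matrix.mul_sub, Matrix.sub_mul, Matrix.mul_one]
    rw [this, hC, mul_inv_rev, Matrix.mul_assoc, ← Matrix.mul_assoc _ (Cᴴ * (E - 1)),
      ← Matrix.mul_assoc _ Cᴴ, nonsing_inv_mul _ hCHu, Matrix.one_mul, trace_mul_comm,
      Matrix.mul_assoc, mul_nonsing_inv _ hCu, Matrix.mul_one]
  rw [hdet, htr, Real.log_mul hA.det_re_pos.ne' hEpos.det_re_pos.ne']
  obtain ⟨h1, h2⟩ := hEpos.log_det_re_le
  refine ⟨by linarith, fun h => ?_⟩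
  rw [hBE, hC, h2 (by linarith), Matrix.mul_one]

/-! ### Hermitian `2 × 2` matrices in real coordinates. -/

/-- The Hermitian matrix `[[a, c†], [c, b]]`. -/
def hermTwo (x : ℝ × ℂ × ℝ) : Matrix (Fin 2) (Fin 2) ℂ :=
  !![(x.1 : ℂ), star x.2.1; x.2.1, (x.2.2 : ℂ)]

theorem isHermitian_hermTwo (x : ℝ × ℂ × ℝ) : (hermTwo x).IsHermitian := by
  ext i j
  fin_cases i <;> fin_cases j <;> simp [hermTwo]

theorem star_dotProduct_hermTwo_mulVec (x : ℝ × ℂ × ℝ) (v : Fin 2 → ℂ) :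
    star v ⬝ᵥ (hermTwo x *ᵥ v) =
      ((x.1 * ‖v 0‖ ^ 2 + 2 * (star (v 1) * x.2.1 * v 0).re + x.2.2 * ‖v 1‖ ^ 2 : ℝ) : ℂ) := by
  apply Complex.ext
  · simp only [Complex.sq_norm, Complex.normSq_apply]
    simp [hermTwo, dotProduct, mulVec, Fin.sum_univ_two]
    ring
  · simp [hermTwo, dotProduct, mulVec, Fin.sum_univ_two, -Complex.ofReal_pow]
    ring

theorem posSemidef_hermTwo_iff (x : ℝ × ℂ × ℝ) :
    (hermTwo x).PosSemidef ↔ 0 ≤ x.1 ∧ 0 ≤ x.2.2 ∧ ‖x.2.1‖ ^ 2 ≤ x.1 * x.2.2 := by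
  constructor
  · intro h
    have h0 := h.diag_nonneg (i := 0)
    have h1 := h.diag_nonneg (i := 1)
    have h2 := (Complex.nonneg_iff.mp h.det_nonneg).1
    simp only [hermTwo, det_fin_two_of, of_apply, cons_val', cons_val_zero, cons_val_one,
      cons_val_fin_one] at h0 h1 h2
    refine ⟨by simpa using h0, by simpa using h1, ?_⟩
    simp [Complex.sq_norm, Complex.normSq_apply] at h2 ⊢
    linarith
  · rintro ⟨h0, h1, h2⟩
    refine PosSemidef.of_dotProduct_mulVec_nonneg (isHermitian_hermTwo x) fun v => ?_
    rw [star_dotProduct_hermTwo_mulVec]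
    norm_cast
    have hre : |(star (v 1) * x.2.1 * v 0).re| ≤ ‖v 1‖ * ‖x.2.1‖ * ‖v 0‖ := by
      refine (Complex.abs_re_le_norm _).trans ?_
      simp
    have hc : ‖x.2.1‖ ≤ Real.sqrt x.1 * Real.sqrt x.2.2 := by
      rw [← Real.sqrt_mul h0]
      exact Real.le_sqrt_of_sq_le h2
    have h3 : ‖v 1‖ * ‖x.2.1‖ * ‖v 0‖ ≤ ‖v 1‖ * (Real.sqrt x.1 * Real.sqrt x.2.2) * ‖v 0‖ := by
      gcongr
    have h4 := neg_abs_le (star (v 1) * x.2.1 * v 0).re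
    -- This square is the quadratic form with its cross term replaced by its lower bound.
    have h5 := sq_nonneg (Real.sqrt x.1 * ‖v 0‖ - Real.sqrt x.2.2 * ‖v 1‖)
    nlinarith [Real.sq_sqrt h0, Real.sq_sqrt h1]

theorem posDef_hermTwo_iff (x : ℝ × ℂ × ℝ) :
    (hermTwo x).PosDef ↔ 0 < x.1 ∧ 0 < x.2.2 ∧ ‖x.2.1‖ ^ 2 < x.1 * x.2.2 := by
  have hdet : (hermTwo x).det = ((x.1 * x.2.2 - ‖x.2.1‖ ^ 2 : ℝ) : ℂ) := by
    simp only [hermTwo, det_fin_two_of]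
    apply Complex.ext
    · simp [Complex.sq_norm, Complex.normSq_apply]
    · simp [Complex.sq_norm, Complex.normSq_apply]
      ring
  constructor
  · intro h
    have h0 := h.diag_pos (i := 0)
    have h1 := h.diag_pos (i := 1)
    have h2 := h.det_pos
    rw [hdet] at h2
    simp only [hermTwo, of_apply, cons_val', cons_val_zero, cons_val_one,
      cons_val_fin_one] at h0 h1
    norm_cast at h0 h1 h2
    exact ⟨h0, h1, by linarith⟩
  · rintro ⟨h0, h1, h2⟩
    have hp := (posSemidef_hermTwo_iff x).mpr ⟨h0.le, h1.le, h2.le⟩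
    rw [hp.posDef_iff_det_ne_zero, hdet]
    norm_cast
    linarith

end Matrix

/-! ### Separation and Lagrange multipliers. -/

/-- Lagrange multipliers for a concave maximization problem with a conic constraint `G x ∈ C`,
`C` an open convex cone, under Slater's condition. -/
theorem ConcaveOn.exists_lagrange_multiplier {V E : Type*} [AddCommGroup V] [Module ℝ V]
    [AddCommGroup E] [Module ℝ E] [TopologicalSpace E] [IsTopologicalAddGroup E]
    [ContinuousSMul ℝ E] {K : Set V} {f : V → ℝ} (hf : ConcaveOn ℝ K f) {G : V → E}
    (hG : ∀ x ∈ K, ∀ y ∈ K, ∀ a b : ℝ, 0 ≤ a → 0 ≤ b → a + b = 1 →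
      G (a • x + b • y) = a • G x + b • G y)
    {C : Set E} (hCo : IsOpen C) (hCc : Convex ℝ C) (hCs : ∀ t : ℝ, 0 < t → ∀ e ∈ C, t • e ∈ C)
    {p : ℝ} (hp : ∀ x ∈ K, G x ∈ C → f x ≤ p) {x₀ : V} (hx₀ : x₀ ∈ K) (hGx₀ : G x₀ ∈ C) :
    ∃ φ : E →L[ℝ] ℝ, (∀ e ∈ C, 0 ≤ φ e) ∧ ∀ x ∈ K, f x + φ (G x) ≤ p := by
  -- A common point of `T` and `K'` would be a feasible `x` with `f x > p`.
  set T : Set (ℝ × E) := Set.Ioi p ×ˢ C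
  set K' : Set (ℝ × E) := {q | ∃ x ∈ K, q.1 ≤ f x ∧ q.2 = G x}
  have hK' : Convex ℝ K' := by
    rintro ⟨s, e⟩ ⟨x, hx, h1, h2⟩ ⟨s', e'⟩ ⟨y, hy, h3, h4⟩ a b ha hb hab
    refine ⟨a • x + b • y, hf.1 hx hy ha hb hab, ?_, ?_⟩
    · refine le_trans ?_ (hf.2 hx hy ha hb hab)
      simp only [Prod.fst_add, Prod.smul_fst, smul_eq_mul] at *
      gcongr
    · simp only [Prod.snd_add, Prod.smul_snd] at *
      rw [hG x hx y hy a b ha hb hab, h2, h4]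
  obtain ⟨ψ, u, hT, hK⟩ := geometric_hahn_banach_open ((convex_Ioi p).prod hCc)
    (isOpen_Ioi.prod hCo) hK' (by
      rw [Set.disjoint_left]
      rintro ⟨s, e⟩ ⟨h1, h2⟩ ⟨x, hx, h3, h4⟩
      simp only [Set.mem_Ioi] at h1 h2 h3 h4
      exact absurd (hp x hx (h4 ▸ h2)) (by linarith))
  set μ : ℝ := -ψ (1, 0) with hμ
  set φ : E →L[ℝ] ℝ := -(ψ.comp (ContinuousLinearMap.inr ℝ ℝ E)) with hφ
  have hψ (s : ℝ) (e : E) : ψ (s, e) = -(μ * s + φ e) := by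
    have : ((s, e) : ℝ × E) = s • (1, 0) + (0, e) := by simp
    rw [this, map_add, map_smul, hμ, hφ]
    simp
    ring
  have hT' (s : ℝ) (e : E) (hs : p < s) (he : e ∈ C) : -u < μ * s + φ e := by
    have := hT (s, e) ⟨hs, he⟩
    rw [hψ] at this
    linarith
  have hK'' (x : V) (hx : x ∈ K) (s : ℝ) (hs : s ≤ f x) : μ * s + φ (G x) ≤ -u := by
    have := hK (s, G x) ⟨x, hx, hs, rfl⟩
    rw [hψ] at this
    linarith
  have hμ0 : 0 ≤ μ := by
    by_contra hneg
    push Not at hneg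
    have h1 := hT' (p + 1) _ (by linarith) hGx₀
    have h2 := hK'' x₀ hx₀ (min (f x₀) p) (min_le_left _ _)
    nlinarith [min_le_right (f x₀) p]
  have hφC (e : E) (he : e ∈ C) : 0 ≤ φ e := by
    by_contra hneg
    push Not at hneg
    obtain ⟨t, ht⟩ := exists_gt (max 1 ((-u - μ * (p + 1)) / φ e))
    have ht1 := (le_max_left _ _).trans_lt ht
    have ht2 := (le_max_right _ _).trans_lt ht
    rw [div_lt_iff_of_neg hneg] at ht2
    have := hT' (p + 1) (t • e) (by linarith) (hCs t (by linarith) e he)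
    rw [map_smul, smul_eq_mul] at this
    linarith
  -- Slater's point excludes a vertical hyperplane: with `μ = 0`, `φ (G x₀)` would lie strictly
  -- above and weakly below `-u`.
  have hμpos : 0 < μ := by
    refine hμ0.lt_of_ne fun h0 => ?_
    have h1 := hT' (p + 1) _ (by linarith) hGx₀
    have h2 := hK'' x₀ hx₀ _ le_rfl
    rw [← h0] at h1 h2
    linarith
  -- Let the value decrease to `p` and shrink `G x₀` to `0` inside `C`. Each of the two errors is at
  -- most a quarter of the supposed gap `δ`.
  have hup : -u ≤ μ * p := by
    by_contra hneg
    push Not at hneg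
    have he := hφC _ hGx₀
    set δ := -u - μ * p with hδ
    have hδ0 : 0 < δ := by linarith
    have h1 := hT' (p + δ / (4 * μ)) ((δ / (4 * (φ (G x₀) + 1))) • G x₀)
      (by have : 0 < δ / (4 * μ) := by positivity
          linarith) (hCs _ (by positivity) _ hGx₀)
    rw [map_smul, smul_eq_mul, mul_add] at h1
    have h2 : μ * (δ / (4 * μ)) = δ / 4 := by field_simp
    have h3 : δ / (4 * (φ (G x₀) + 1)) * φ (G x₀) ≤ δ / 4 := by
      rw [div_mul_eq_mul_div, div_le_div_iff₀ (by positivity) (by positivity)]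
      nlinarith
    linarith
  refine ⟨μ⁻¹ • φ, fun e he => ?_, fun x hx => ?_⟩
  · simp only [_root_.smul_apply, smul_eq_mul]
    exact mul_nonneg (by positivity) (hφC e he)
  · have := (hK'' x hx _ le_rfl).trans hup
    simp only [_root_.smul_apply, smul_eq_mul]
    have h2 : μ * (f x + μ⁻¹ * φ (G x)) ≤ μ * p := by
      rw [mul_add, mul_inv_cancel_left₀ hμpos.ne']
      exact this
    exact le_of_mul_le_mul_left h2 hμpos


/-! ### Compactness, kernels and self-duality of the semidefinite cone. -/

namespace Matrix

theorem isClosed_setOf_posSemidef {n : Type*} [Fintype n] :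
    IsClosed {A : Matrix n n ℂ | A.PosSemidef} := by
  have : {A : Matrix n n ℂ | A.PosSemidef} =
      {A | Aᴴ = A} ∩ ⋂ v : n → ℂ, {A | 0 ≤ star v ⬝ᵥ (A *ᵥ v)} := by
    ext A
    simp [posSemidef_iff_dotProduct_mulVec, IsHermitian]
  rw [this]
  refine (isClosed_eq (by fun_prop) (by fun_prop)).inter (isClosed_iInter fun v => ?_)
  exact isClosed_le continuous_const (by fun_prop)

theorem isCompact_setOf_posSemidef_trace_le {n : Type*} [Fintype n] (P : ℝ) :
    IsCompact {A : Matrix n n ℂ | A.PosSemidef ∧ A.trace.re ≤ P} := by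
  have hc : IsCompact (Set.univ.pi fun _ : n => Set.univ.pi fun _ : n =>
      Metric.closedBall (0 : ℂ) P) :=
    isCompact_univ_pi fun _ => isCompact_univ_pi fun _ => isCompact_closedBall _ _
  refine hc.of_isClosed_subset (isClosed_setOf_posSemidef.inter
    (isClosed_le (Complex.continuous_re.comp continuous_id.matrix_trace) continuous_const)) ?_
  rintro A ⟨hA, hP⟩ i - j -
  rw [mem_closedBall_zero_iff]
  exact (hA.norm_apply_le_trace i j).trans hP

theorem det_one_add_vecMulVec {n : Type*} [Fintype n] [DecidableEq n] (u v : n → ℂ) :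
    (1 + vecMulVec u v).det = 1 + v ⬝ᵥ u := by
  rw [vecMulVec_eq Unit, det_one_add_replicateCol_mul_replicateRow]

theorem star_dotProduct_self_eq {n : Type*} [Fintype n] (v : n → ℂ) :
    star v ⬝ᵥ v = ((∑ i, ‖v i‖ ^ 2 : ℝ) : ℂ) := by
  simp only [dotProduct, Pi.star_apply, Complex.star_def, Complex.ofReal_sum]
  exact Finset.sum_congr rfl fun i _ => by rw [Complex.conj_mul']; norm_cast

theorem IsHermitian.trace_mul_conj {n : Type*} [Fintype n] {A : Matrix n n ℂ}
    (hA : A.IsHermitian) (B : Matrix n n ℂ) : (Bᴴ * A).trace = star (B * A).trace := by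
  rw [← trace_conjTranspose, conjTranspose_mul, hA.eq, trace_mul_comm]

/-- A Hermitian matrix whose kernel annihilates `H` divides `H` on the right. -/
theorem IsHermitian.exists_eq_mul_of_ker_le {m n : Type*} [Fintype m] [Fintype n]
    {D : Matrix n n ℂ} (hD : D.IsHermitian) {H : Matrix m n ℂ}
    (hker : ∀ v, D *ᵥ v = 0 → H *ᵥ v = 0) : ∃ X : Matrix m n ℂ, H = X * D := by
  classical
  set U : Matrix n n ℂ := ↑hD.eigenvectorUnitary with hU
  set d : n → ℂ := fun i => (hD.eigenvalues i : ℂ) with hd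
  have hUU : star U * U = 1 := Unitary.coe_star_mul_self _
  have hspec : D = U * diagonal d * star U := by
    conv_lhs => rw [hD.spectral_theorem]
    rfl
  -- Since `0⁻¹ = 0`, this is the pseudoinverse of `D`, so `D E D = D`. The columns of `1 - E D`
  -- then lie in the kernel of `D`.
  set E : Matrix n n ℂ := U * diagonal (fun i => (d i)⁻¹) * star U with hE
  have h0 : D * (1 - E * D) = 0 := by
    have hdd : diagonal d * diagonal (fun i => (d i)⁻¹) * diagonal d = diagonal d := by
      rw [diagonal_mul_diagonal, diagonal_mul_diagonal]
      congr 1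
      funext i
      exact mul_inv_mul_cancel (d i)
    have : D * E * D = D := by
      calc D * E * D = U * diagonal d * (star U * U) * diagonal (fun i => (d i)⁻¹) *
            (star U * U) * diagonal d * star U := by
              rw [hspec, hE]; simp only [Matrix.mul_assoc]
        _ = U * (diagonal d * diagonal (fun i => (d i)⁻¹) * diagonal d) * star U := by
              rw [hUU]; simp only [Matrix.mul_assoc, Matrix.one_mul]
        _ = D := by rw [hdd, hspec]
    rw [Matrix.mul_sub, Matrix.mul_one, ← Matrix.mul_assoc, this, sub_self]
  have h1 : H * (1 - E * D) = 0 := by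
    refine ext_of_mulVec_single fun j => ?_
    rw [← mulVec_mulVec, hker _ (by rw [mulVec_mulVec, h0, zero_mulVec]), zero_mulVec]
  refine ⟨H * E, ?_⟩
  rw [Matrix.mul_sub, Matrix.mul_one, sub_eq_zero] at h1
  rw [Matrix.mul_assoc, ← h1]

/-- Every linear functional on the Hermitian `2 × 2` matrices is a trace pairing. -/
theorem exists_trace_hermTwo_mul (φ : (ℝ × ℂ × ℝ) →L[ℝ] ℝ) :
    ∃ z : ℝ × ℂ × ℝ, ∀ x, φ x = (hermTwo z * hermTwo x).trace.re := by
  -- The off-diagonal coordinate is halved because it enters the trace twice, once conjugated.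
  refine ⟨(φ (1, 0, 0), ⟨φ (0, 1, 0) / 2, φ (0, Complex.I, 0) / 2⟩, φ (0, 0, 1)), fun x => ?_⟩
  have hx : x = x.1 • (1, 0, 0) + x.2.1.re • (0, 1, 0) + x.2.1.im • (0, Complex.I, 0) +
      x.2.2 • (0, 0, 1) := by
    refine Prod.ext ?_ (Prod.ext ?_ ?_)
    · simp
    · apply Complex.ext <;> simp
    · simp
  conv_lhs => rw [hx]
  simp only [map_add, map_smul, smul_eq_mul]
  simp [hermTwo, trace_fin_two]
  ring

/-- Self-duality of the cone. Only positive definite test matrices are allowed, so `v vᴴ` is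
replaced by `v vᴴ + δ I`, with `δ` so small that the error is at most `ε`. -/
theorem posSemidef_hermTwo_of_pairing_nonneg {z : ℝ × ℂ × ℝ}
    (hz : ∀ x, (hermTwo x).PosDef → 0 ≤ (hermTwo z * hermTwo x).trace.re) :
    (hermTwo z).PosSemidef := by
  refine PosSemidef.of_dotProduct_mulVec_nonneg (isHermitian_hermTwo z) fun v => ?_
  rw [star_dotProduct_hermTwo_mulVec]
  norm_cast
  refine le_of_forall_pos_le_add fun ε hε => ?_
  set δ : ℝ := ε / (|z.1| + |z.2.2| + 1) with hδ
  have hδ0 : 0 < δ := by positivity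
  have hp : (hermTwo (‖v 0‖ ^ 2 + δ, v 1 * star (v 0), ‖v 1‖ ^ 2 + δ)).PosDef := by
    rw [posDef_hermTwo_iff]
    refine ⟨by positivity, by positivity, ?_⟩
    simp only [norm_mul, norm_star]
    nlinarith [sq_nonneg (‖v 0‖), sq_nonneg (‖v 1‖), mul_pos hδ0 hδ0]
  have h := hz _ hp
  have h2 : (hermTwo z * hermTwo (‖v 0‖ ^ 2 + δ, v 1 * star (v 0), ‖v 1‖ ^ 2 + δ)).trace.re =
      z.1 * ‖v 0‖ ^ 2 + 2 * (star (v 1) * z.2.1 * v 0).re + z.2.2 * ‖v 1‖ ^ 2 +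
        δ * (z.1 + z.2.2) := by
    simp [hermTwo, trace_fin_two, -Complex.ofReal_pow]
    ring
  rw [h2] at h
  have h3 : δ * (z.1 + z.2.2) ≤ ε := by
    rw [hδ, div_mul_eq_mul_div, div_le_iff₀ (by positivity)]
    nlinarith [le_abs_self z.1, le_abs_self z.2.2]
  linarith

theorem isOpen_setOf_posDef_hermTwo : IsOpen {x : ℝ × ℂ × ℝ | (hermTwo x).PosDef} := by
  simp only [posDef_hermTwo_iff]
  have h1 : IsOpen {x : ℝ × ℂ × ℝ | 0 < x.1} := isOpen_lt (by fun_prop) (by fun_prop)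
  have h2 : IsOpen {x : ℝ × ℂ × ℝ | 0 < x.2.2} := isOpen_lt (by fun_prop) (by fun_prop)
  have h3 : IsOpen {x : ℝ × ℂ × ℝ | ‖x.2.1‖ ^ 2 < x.1 * x.2.2} :=
    isOpen_lt (by fun_prop) (by fun_prop)
  exact h1.inter (h2.inter h3)

theorem hermTwo_add (x y : ℝ × ℂ × ℝ) : hermTwo (x + y) = hermTwo x + hermTwo y := by
  ext i j
  fin_cases i <;> fin_cases j <;> simp [hermTwo]

theorem hermTwo_smul (t : ℝ) (x : ℝ × ℂ × ℝ) : hermTwo (t • x) = t • hermTwo x := by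
  ext i j
  fin_cases i <;> fin_cases j <;> simp [hermTwo]

theorem PosDef.hermTwo_smul {x : ℝ × ℂ × ℝ} (hx : (hermTwo x).PosDef) {t : ℝ} (ht : 0 < t) :
    (hermTwo (t • x)).PosDef := by
  rw [Matrix.hermTwo_smul]
  exact hx.smul ht

theorem convex_setOf_posDef_hermTwo : Convex ℝ {x : ℝ × ℂ × ℝ | (hermTwo x).PosDef} := by
  rw [convex_iff_forall_pos]
  intro x hx y hy a b ha hb _
  rw [Set.mem_ofPred_eq, hermTwo_add]
  exact (PosDef.hermTwo_smul hx ha).add (PosDef.hermTwo_smul hy hb)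

end Matrix

/-! ### Rate, CRB constraint and existence of a primal optimum. -/

noncomputable section
namespace MultiFunMIMO.SystemModel

variable {M NS NEH NID : ℕ} (sys : SystemModel M NS NEH NID)

/-- The matrix `I + σ_ID⁻² H_ID S H_IDᴴ` whose determinant gives the rate. -/
def rateMatrix (S : Matrix (Fin M) (Fin M) ℂ) : Matrix (Fin NID) (Fin NID) ℂ :=
  1 + ((1 / sys.σID ^ 2 : ℝ) : ℂ) • (sys.HID * S * sys.HIDᴴ)

theorem rate_eq (S : Matrix (Fin M) (Fin M) ℂ) :
    sys.rate S = Real.log (sys.rateMatrix S).det.re / Real.log 2 := rfl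

theorem rateMatrix_posDef {S : Matrix (Fin M) (Fin M) ℂ} (hS : S.PosSemidef) :
    (sys.rateMatrix S).PosDef := by
  refine PosDef.one.add_posSemidef ((hS.mul_mul_conjTranspose_same _).smul ?_)
  rw [Complex.zero_le_real]
  positivity

variable {sys}

/-- Average the tangent inequalities taken at the convex combination `W₀`; the linear terms cancel.
-/
theorem concaveOn_rate : ConcaveOn ℝ {S : Matrix (Fin M) (Fin M) ℂ | S.PosSemidef} sys.rate := by
  have hconv : Convex ℝ {S : Matrix (Fin M) (Fin M) ℂ | S.PosSemidef} := by
    intro S hS T hT a b ha hb _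
    exact (PosSemidef.smul hS ha).add (PosSemidef.smul hT hb)
  refine ⟨hconv, fun S hS T hT a b ha hb hab => ?_⟩
  have h0 := sys.rateMatrix_posDef (hconv hS hT ha hb hab)
  have h1 := (h0.log_det_re_le_tangent (sys.rateMatrix_posDef hS)).1
  have h2 := (h0.log_det_re_le_tangent (sys.rateMatrix_posDef hT)).1
  set W₀ := sys.rateMatrix (a • S + b • T)
  have hsum : a • (sys.rateMatrix S - W₀) + b • (sys.rateMatrix T - W₀) = 0 := by
    have : W₀ = a • sys.rateMatrix S + b • sys.rateMatrix T := by
      simp only [W₀, rateMatrix, smul_add, Matrix.mul_add, Matrix.add_mul, Matrix.mul_smul,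
        Matrix.smul_mul, smul_comm a ((1 / sys.σID ^ 2 : ℝ) : ℂ),
        smul_comm b ((1 / sys.σID ^ 2 : ℝ) : ℂ)]
      rw [add_add_add_comm, ← add_smul, hab, one_smul]
    rw [smul_sub, smul_sub, sub_add_sub_comm, ← add_smul, hab, one_smul, ← this, sub_self]
  have htr : a * (W₀⁻¹ * (sys.rateMatrix S - W₀)).trace.re +
      b * (W₀⁻¹ * (sys.rateMatrix T - W₀)).trace.re = 0 := by
    have := congrArg (fun X => (W₀⁻¹ * X).trace.re) hsum
    simpa [Matrix.mul_add] using this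
  have hlog : 0 < Real.log 2 := Real.log_pos (by norm_num)
  simp only [rate_eq, smul_eq_mul]
  rw [← mul_div_assoc, ← mul_div_assoc, ← add_div]
  refine div_le_div_of_nonneg_right ?_ hlog.le
  have : a * Real.log W₀.det.re + b * Real.log W₀.det.re = Real.log W₀.det.re := by
    rw [← add_mul, hab, one_mul]
  nlinarith [mul_le_mul_of_nonneg_left h1 ha, mul_le_mul_of_nonneg_left h2 hb]

theorem continuousOn_rate :
    ContinuousOn sys.rate {S : Matrix (Fin M) (Fin M) ℂ | S.PosSemidef} := by
  have hc : Continuous fun S : Matrix (Fin M) (Fin M) ℂ => (sys.rateMatrix S).det.re := by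
    refine Complex.continuous_re.comp (Continuous.matrix_det ?_)
    unfold rateMatrix
    fun_prop
  have : sys.rate = fun S => Real.log (sys.rateMatrix S).det.re / Real.log 2 :=
    funext sys.rate_eq
  rw [this]
  exact (hc.continuousOn.log fun S hS => (sys.rateMatrix_posDef hS).det_re_pos.ne').div_const _

variable (sys) in
/-- The real coordinates of the Hermitian matrix `crbMatrix`. -/
def sensing (S : Matrix (Fin M) (Fin M) ℂ) : ℝ × ℂ × ℝ :=
  ((sys.dAᴴ * sys.dA * S).trace.re - 1 / sys.ΓS1, (sys.dAᴴ * sys.A * S).trace,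
    (sys.Aᴴ * sys.A * S).trace.re)

theorem ofReal_re_trace_gram_mul {m : ℕ} (B : Matrix (Fin m) (Fin M) ℂ)
    {S : Matrix (Fin M) (Fin M) ℂ} (hS : S.PosSemidef) :
    (((Bᴴ * B * S).trace.re : ℝ) : ℂ) = (Bᴴ * B * S).trace :=
  Complex.ext rfl
    (Complex.nonneg_iff.mp ((posSemidef_conjTranspose_mul_self B).trace_mul_nonneg hS)).2

theorem re_trace_gram_mul_nonneg {m : ℕ} (B : Matrix (Fin m) (Fin M) ℂ)
    {S : Matrix (Fin M) (Fin M) ℂ} (hS : S.PosSemidef) : 0 ≤ (Bᴴ * B * S).trace.re :=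
  (Complex.nonneg_iff.mp ((posSemidef_conjTranspose_mul_self B).trace_mul_nonneg hS)).1

theorem crbMatrix_eq {S : Matrix (Fin M) (Fin M) ℂ} (hS : S.PosSemidef) :
    sys.crbMatrix S = hermTwo (sys.sensing S) := by
  unfold crbMatrix hermTwo sensing
  rw [← ofReal_re_trace_gram_mul _ hS, ← ofReal_re_trace_gram_mul sys.A hS]
  simp

/-- If `tr(AᴴAS) > 0`, clearing denominators gives the determinant condition. If it vanishes, then
`A S = 0`, the off-diagonal entry vanishes too, and both sides bound `tr(ȦᴴȦS)` from below. -/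
theorem crb_le_iff (hα : sys.α ≠ 0) (hL : 0 < sys.L) (hσS : 0 < sys.σS) (hΓS : 0 < sys.ΓS)
    {S : Matrix (Fin M) (Fin M) ℂ} (hS : S.PosSemidef) :
    sys.crb S ≤ ENNReal.ofReal sys.ΓS ↔ (sys.crbMatrix S).PosSemidef := by
  have hα' : 0 < ‖sys.α‖ := norm_pos_iff.mpr hα
  have hL' : (0 : ℝ) < sys.L := by exact_mod_cast hL
  have hc : 0 < sys.crbConst := by unfold crbConst; positivity
  have hΓ1 : 1 / sys.ΓS1 = sys.crbConst / sys.ΓS := by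
    unfold ΓS1 crbConst
    field_simp
  have ht := re_trace_gram_mul_nonneg sys.A hS
  -- For `y ≤ 0` the truncated denominator is `0` and the quotient is `∞`, in agreement with the
  -- failure of the right side.
  have key (x y : ℝ) (hx : 0 < x) : ENNReal.ofReal x / ENNReal.ofReal y ≤ ENNReal.ofReal sys.ΓS ↔
      x / sys.ΓS ≤ y := by
    rcases le_or_gt y 0 with hy | hy
    · have h1 : ¬ x / sys.ΓS ≤ y := by
        have : 0 < x / sys.ΓS := by positivity
        linarith
      rw [ENNReal.ofReal_of_nonpos hy, ENNReal.div_zero (by simpa using hx)]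
      simp [h1]
    · rw [← ENNReal.ofReal_div_of_pos hy, ENNReal.ofReal_le_ofReal_iff hΓS.le,
        div_le_iff₀ hy, div_le_iff₀ hΓS, mul_comm y]
  rw [crbMatrix_eq hS, posSemidef_hermTwo_iff]
  unfold crb sensing
  simp only [hΓ1]
  split_ifs with h0
  · have hA0 : sys.A * S = 0 := by
      obtain ⟨C, hC⟩ := hS.exists_eq_conjTranspose_mul_self
      have h1 : (sys.Aᴴ * sys.A * S).trace = ((C * sys.Aᴴ) * (C * sys.Aᴴ)ᴴ).trace := by
        rw [hC, conjTranspose_mul, conjTranspose_conjTranspose, trace_mul_comm, Matrix.mul_assoc,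
          trace_mul_comm]
        simp only [Matrix.mul_assoc]
      have h2 : (sys.Aᴴ * sys.A * S).trace = 0 := by
        rw [← ofReal_re_trace_gram_mul _ hS, h0, Complex.ofReal_zero]
      rw [h1, trace_mul_conjTranspose_self_eq_zero_iff] at h2
      have h3 : sys.A * Cᴴ = 0 := by
        rw [← conjTranspose_eq_zero, conjTranspose_mul, conjTranspose_conjTranspose, h2]
      rw [hC, ← Matrix.mul_assoc, h3, Matrix.zero_mul]
    rw [key _ _ hc, h0, Matrix.mul_assoc, Matrix.mul_assoc _ sys.A, hA0]
    simp
  · have ht' : 0 < (sys.Aᴴ * sys.A * S).trace.re := ht.lt_of_ne' h0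
    rw [key _ _ (by positivity)]
    generalize (sys.Aᴴ * sys.A * S).trace.re = t at *
    generalize (sys.dAᴴ * sys.dA * S).trace.re = d
    generalize ‖(sys.dAᴴ * sys.A * S).trace‖ = x
    rw [mul_div_right_comm, sub_mul]
    generalize sys.crbConst / sys.ΓS = c
    constructor
    · intro h
      refine ⟨?_, ht, by linarith⟩
      by_contra hneg
      push Not at hneg
      nlinarith [sq_nonneg x]
    · rintro ⟨-, -, h⟩
      linarith

theorem mem_feasibleSet_iff (hα : sys.α ≠ 0) (hL : 0 < sys.L) (hσS : 0 < sys.σS)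
    (hΓS : 0 < sys.ΓS) (S : Matrix (Fin M) (Fin M) ℂ) :
    S ∈ sys.feasibleSet ↔ sys.SatisfiesConvexConstraints S := by
  constructor
  · rintro ⟨h1, h2, h3, h4⟩
    exact ⟨h1, h2, h4, (crb_le_iff hα hL hσS hΓS h1).mp h3⟩
  · rintro ⟨h1, h2, h3, h4⟩
    exact ⟨h1, h2, (crb_le_iff hα hL hσS hΓS h1).mpr h4, h3⟩

theorem continuous_energy : Continuous sys.energy := by
  refine Complex.continuous_re.comp (Continuous.matrix_trace ?_)
  fun_prop

theorem continuous_crbMatrix : Continuous sys.crbMatrix := by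
  have h (B : Matrix (Fin M) (Fin M) ℂ) : Continuous fun S => (B * S).trace :=
    (continuous_const.matrix_mul continuous_id).matrix_trace
  refine continuous_matrix fun i j => ?_
  fin_cases i <;> fin_cases j
  · exact (h _).sub continuous_const
  · exact (h _).star
  · exact h _
  · exact h _

theorem exists_isOptimal (hα : sys.α ≠ 0) (hL : 0 < sys.L) (hσS : 0 < sys.σS) (hΓS : 0 < sys.ΓS)
    (hSlater : sys.Slater) : ∃ S, sys.IsOptimal S := by
  have hset : sys.feasibleSet = {S | S.PosSemidef ∧ S.trace.re ≤ sys.P} ∩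
      ({S | sys.ΓEH ≤ sys.energy S} ∩ sys.crbMatrix ⁻¹' {Z | Z.PosSemidef}) := by
    ext S
    rw [mem_feasibleSet_iff hα hL hσS hΓS]
    exact ⟨fun ⟨h1, h2, h3, h4⟩ => ⟨⟨h1, h3⟩, h2, h4⟩, fun ⟨⟨h1, h3⟩, h2, h4⟩ => ⟨h1, h2, h3, h4⟩⟩
  have hcomp : IsCompact sys.feasibleSet := by
    rw [hset]
    exact (isCompact_setOf_posSemidef_trace_le sys.P).inter_right
      ((isClosed_le continuous_const continuous_energy).inter
        (isClosed_setOf_posSemidef.preimage continuous_crbMatrix))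
  obtain ⟨S₀, h1, h2, h3, h4⟩ := hSlater
  have hne : sys.feasibleSet.Nonempty :=
    ⟨S₀, (mem_feasibleSet_iff hα hL hσS hΓS _).mpr ⟨h1, h2.le, h3.le, h4.posSemidef⟩⟩
  obtain ⟨S, hS, hmax⟩ := hcomp.exists_isMaxOn hne (continuousOn_rate.mono fun S hS => hS.1)
  exact ⟨S, hS, hmax⟩

/-! ### Lagrangian duality. -/

/-- Regrouping `D` by constraint pairs each multiplier with the slack of its constraint, the form
that weak duality and separation use. -/
theorem lagrangian_eq {S : Matrix (Fin M) (Fin M) ℂ} (hS : S.PosSemidef) (lam nu : ℝ)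
    {Z : Matrix (Fin 2) (Fin 2) ℂ} (hZ : Z.IsHermitian) :
    sys.lagrangian S lam nu Z = sys.rate S + lam * (sys.energy S - sys.ΓEH) +
      nu * (sys.P - S.trace.re) + (Z * sys.crbMatrix S).trace.re := by
  have h1 : (sys.HEHᴴ * sys.HEH * S).trace.re = sys.energy S := by
    rw [energy, ← trace_mul_cycle, Matrix.mul_assoc]
  have h2 : (sys.Aᴴ * sys.dA * S).trace = star (sys.dAᴴ * sys.A * S).trace := by
    rw [← hS.1.trace_mul_conj, conjTranspose_mul, conjTranspose_conjTranspose]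
  have hz : star (Z 0 1) = Z 1 0 := hZ.apply 1 0
  have hz' : star (Z 1 0) = Z 0 1 := hZ.apply 0 1
  have h00 : (Z 0 0).im = 0 := by
    have := hZ.coe_re_apply_self 0
    rw [← this]; simp
  unfold lagrangian D crbMatrix
  simp only [Matrix.sub_mul, Matrix.smul_mul, Matrix.one_mul, trace_sub, trace_smul,
    Complex.sub_re, smul_eq_mul, h1, h2, trace_fin_two, Matrix.mul_apply,
    Fin.sum_univ_two, of_apply, cons_val', cons_val_zero, cons_val_one, cons_val_fin_one, hz,
    Complex.add_re, mul_sub, Complex.mul_re, Complex.ofReal_re, Complex.ofReal_im, h00]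
  rw [← hz']
  simp only [Complex.star_def, Complex.conj_re, Complex.conj_im]
  ring

theorem rate_le_lagrangian {S : Matrix (Fin M) (Fin M) ℂ}
    (hS : sys.SatisfiesConvexConstraints S) {lam nu : ℝ} {Z : Matrix (Fin 2) (Fin 2) ℂ}
    (hlam : 0 ≤ lam) (hnu : 0 ≤ nu) (hZ : Z.PosSemidef) :
    sys.rate S ≤ sys.lagrangian S lam nu Z := by
  rw [lagrangian_eq hS.posSemidef lam nu hZ.1]
  have h1 := mul_nonneg hlam (sub_nonneg.mpr hS.energy_ge)
  have h2 := mul_nonneg hnu (sub_nonneg.mpr hS.power_le)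
  have h3 := (Complex.nonneg_iff.mp (hZ.trace_mul_nonneg hS.crbMatrix_posSemidef)).1
  linarith

/-- The separating functional on the slack space splits into two scalars and a trace pairing, which
are `λ`, `ν` and `Z`. -/
theorem exists_lagrange_multipliers (hSlater : sys.Slater) {p : ℝ}
    (hp : ∀ S, sys.SatisfiesConvexConstraints S → sys.rate S ≤ p) :
    ∃ (lam nu : ℝ) (Z : Matrix (Fin 2) (Fin 2) ℂ), 0 ≤ lam ∧ 0 ≤ nu ∧ Z.PosSemidef ∧
      ∀ S : Matrix (Fin M) (Fin M) ℂ, S.PosSemidef → sys.lagrangian S lam nu Z ≤ p := by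
  set G : Matrix (Fin M) (Fin M) ℂ → ℝ × ℝ × (ℝ × ℂ × ℝ) := fun S =>
    (sys.energy S - sys.ΓEH, sys.P - S.trace.re, sys.sensing S) with hGdef
  set C : Set (ℝ × ℝ × (ℝ × ℂ × ℝ)) :=
    Set.Ioi 0 ×ˢ Set.Ioi 0 ×ˢ {x | (hermTwo x).PosDef} with hCdef
  have hG (S T : Matrix (Fin M) (Fin M) ℂ) (a b : ℝ) (hab : a + b = 1) :
      G (a • S + b • T) = a • G S + b • G T := by
    have hb : b = 1 - a := by linarith
    simp only [hGdef, energy, sensing, Matrix.mul_add, Matrix.add_mul, Matrix.mul_smul,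
      Matrix.smul_mul, trace_add, trace_smul, Complex.add_re, Complex.smul_re, smul_eq_mul,
      Prod.smul_mk, Prod.mk_add_mk, hb]
    refine Prod.ext ?_ (Prod.ext ?_ (Prod.ext ?_ (Prod.ext ?_ ?_))) <;> simp <;> ring
  obtain ⟨S₀, h1, h2, h3, h4⟩ := hSlater
  have hpos (e : ℝ × ℝ × (ℝ × ℂ × ℝ)) (he : e ∈ C) (t : ℝ) (ht : 0 < t) : t • e ∈ C :=
    ⟨mul_pos ht he.1, mul_pos ht he.2.1, PosDef.hermTwo_smul he.2.2 ht⟩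
  obtain ⟨φ, hφ, hle⟩ := (concaveOn_rate (sys := sys)).exists_lagrange_multiplier (G := G)
    (fun S _ T _ a b _ _ hab => hG S T a b hab) (C := C)
    (isOpen_Ioi.prod (isOpen_Ioi.prod isOpen_setOf_posDef_hermTwo))
    ((convex_Ioi 0).prod ((convex_Ioi 0).prod convex_setOf_posDef_hermTwo))
    (fun t ht e he => hpos e he t ht) (p := p)
    (fun S hS hGS => hp S ⟨hS, (sub_pos.mp hGS.1).le, (sub_pos.mp hGS.2.1).le,
      by rw [crbMatrix_eq hS]; exact hGS.2.2.posSemidef⟩) (x₀ := S₀) h1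
    ⟨sub_pos.mpr h2, sub_pos.mpr h3, by rw [crbMatrix_eq h1] at h4; exact h4⟩
  set φ₃ : (ℝ × ℂ × ℝ) →L[ℝ] ℝ := (φ.comp (ContinuousLinearMap.inr ℝ ℝ _)).comp
    (ContinuousLinearMap.inr ℝ ℝ _) with hφ₃
  obtain ⟨z, hz⟩ := exists_trace_hermTwo_mul φ₃
  have hdec (b c : ℝ) (x : ℝ × ℂ × ℝ) :
      φ (b, c, x) = b * φ (1, 0, 0) + c * φ (0, 1, 0) + (hermTwo z * hermTwo x).trace.re := by
    have : ((b, c, x) : ℝ × ℝ × (ℝ × ℂ × ℝ)) = b • (1, 0, 0) + c • (0, 1, 0) + (0, 0, x) := by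
      simp
    rw [this, map_add, map_add, map_smul, map_smul, ← hz]
    simp [hφ₃]
  -- nonnegativity on `C` passes to its closure by a limit along rays
  have hlim (e d : ℝ × ℝ × (ℝ × ℂ × ℝ)) (h : ∀ ε : ℝ, 0 < ε → e + ε • d ∈ C) : 0 ≤ φ e := by
    refine le_of_forall_pos_le_add fun ε hε => ?_
    have hδ : 0 < ε / (|φ d| + 1) := by positivity
    have h1 := hφ _ (h _ hδ)
    rw [map_add, map_smul, smul_eq_mul] at h1
    have h2 : ε / (|φ d| + 1) * φ d ≤ ε := by
      rw [div_mul_eq_mul_div, div_le_iff₀ (by positivity)]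
      nlinarith [le_abs_self (φ d)]
    linarith
  have hone : (hermTwo (1, 0, 1)).PosDef := by rw [posDef_hermTwo_iff]; simp
  refine ⟨φ (1, 0, 0), φ (0, 1, 0), hermTwo z, ?_, ?_, ?_, fun S hS => ?_⟩
  · refine hlim _ (0, 1, (1, 0, 1)) fun ε hε => ⟨by simp, by simpa using hε, ?_⟩
    simpa using PosDef.hermTwo_smul hone hε
  · refine hlim _ (1, 0, (1, 0, 1)) fun ε hε => ⟨by simpa using hε, by simp, ?_⟩
    simpa using PosDef.hermTwo_smul hone hε
  · refine posSemidef_hermTwo_of_pairing_nonneg fun x hx => ?_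
    have h0 : φ (0, 0, x) = (hermTwo z * hermTwo x).trace.re := by rw [hdec]; ring
    rw [← h0]
    exact hlim _ (1, 1, 0) fun ε hε => ⟨by simpa using hε, by simpa using hε, by simpa using hx⟩
  · rw [lagrangian_eq hS _ _ (isHermitian_hermTwo z), crbMatrix_eq hS]
    have h := hle S hS
    rw [show G S = (_, _, _) from rfl, hdec] at h
    linarith

theorem isHermitian_D (lam nu : ℝ) {Z : Matrix (Fin 2) (Fin 2) ℂ} (hZ : Z.IsHermitian) :
    (sys.D lam nu Z).IsHermitian := by
  have h00 : star (Z 0 0) = Z 0 0 := hZ.apply 0 0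
  have h11 : star (Z 1 1) = Z 1 1 := hZ.apply 1 1
  unfold D IsHermitian
  simp only [conjTranspose_sub, conjTranspose_smul, conjTranspose_mul, conjTranspose_one,
    conjTranspose_conjTranspose, h00, h11, Complex.star_def, Complex.conj_ofReal,
    Complex.conj_conj]
  abel

theorem rate_rankOne (t : ℝ) (v : Fin M → ℂ) :
    sys.rate (t • vecMulVec v (star v)) =
      Real.logb 2 (1 + 1 / sys.σID ^ 2 * t * ∑ i, ‖(sys.HID *ᵥ v) i‖ ^ 2) := by
  have h : sys.HID * (t • vecMulVec v (star v)) * sys.HIDᴴ =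
      t • vecMulVec (sys.HID *ᵥ v) (star (sys.HID *ᵥ v)) := by
    rw [Matrix.mul_smul, Matrix.smul_mul, mul_vecMulVec, vecMulVec_mul, star_mulVec]
  have h2 : (1 + ((1 / sys.σID ^ 2 : ℝ) : ℂ) • t • vecMulVec (sys.HID *ᵥ v)
      (star (sys.HID *ᵥ v))).det =
      ((1 + 1 / sys.σID ^ 2 * t * ∑ i, ‖(sys.HID *ᵥ v) i‖ ^ 2 : ℝ) : ℂ) := by
    rw [← smul_vecMulVec, ← smul_vecMulVec, det_one_add_vecMulVec, dotProduct_smul,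
      dotProduct_smul, star_dotProduct_self_eq]
    simp only [Complex.real_smul, smul_eq_mul]
    push_cast
    ring
  rw [rate, h, h2, Complex.ofReal_re]

theorem trace_mul_rankOne (D : Matrix (Fin M) (Fin M) ℂ) (t : ℝ) (v : Fin M → ℂ) :
    (D * (t • vecMulVec v (star v))).trace.re = t * (star v ⬝ᵥ (D *ᵥ v)).re := by
  rw [Matrix.mul_smul, mul_vecMulVec, trace_smul, trace_vecMulVec, Complex.smul_re, smul_eq_mul,
    dotProduct_comm]

/-- Test the Lagrangian on the rays `t v vᴴ`. If `vᴴ D v < 0` it grows linearly; if `D v = 0` but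
`H_ID v ≠ 0` it grows logarithmically. So `ker D ⊆ ker H_ID`, which is the range inclusion for the
adjoints. -/
theorem isDualFeasible_of_bddAbove (hσID : 0 < sys.σID) {lam nu : ℝ}
    {Z : Matrix (Fin 2) (Fin 2) ℂ} (hlam : 0 ≤ lam) (hnu : 0 ≤ nu) (hZ : Z.PosSemidef) {p : ℝ}
    (hp : ∀ S : Matrix (Fin M) (Fin M) ℂ, S.PosSemidef → sys.lagrangian S lam nu Z ≤ p) :
    sys.IsDualFeasible lam nu Z := by
  have hD := isHermitian_D (sys := sys) lam nu hZ.1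
  obtain ⟨B, hB⟩ : ∃ B : ℝ, ∀ (t : ℝ), 0 ≤ t → ∀ v : Fin M → ℂ,
      Real.logb 2 (1 + 1 / sys.σID ^ 2 * t * ∑ i, ‖(sys.HID *ᵥ v) i‖ ^ 2) -
        t * (star v ⬝ᵥ (sys.D lam nu Z *ᵥ v)).re ≤ B := by
    refine ⟨p + lam * sys.ΓEH - nu * sys.P + (Z 0 0).re / sys.ΓS1, fun t ht v => ?_⟩
    have := hp (t • vecMulVec v (star v)) ((posSemidef_vecMulVec_self_star v).smul ht)
    rw [lagrangian, rate_rankOne, trace_mul_rankOne] at this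
    linarith
  refine ⟨hlam, hnu, hZ, ?_, ?_⟩
  · refine PosSemidef.of_dotProduct_mulVec_nonneg hD fun v => ?_
    rw [Complex.nonneg_iff]
    refine ⟨?_, (hD.im_star_dotProduct_mulVec_self v).symm⟩
    by_contra hneg
    push Not at hneg
    obtain ⟨t, ht⟩ := exists_gt (max 0 (B / -(star v ⬝ᵥ (sys.D lam nu Z *ᵥ v)).re))
    have ht0 := (le_max_left _ _).trans_lt ht
    have ht1 := (le_max_right _ _).trans_lt ht
    rw [div_lt_iff₀ (by linarith)] at ht1
    have h1 := hB t ht0.le v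
    have h2 : 0 ≤ Real.logb 2 (1 + 1 / sys.σID ^ 2 * t * ∑ i, ‖(sys.HID *ᵥ v) i‖ ^ 2) := by
      refine Real.logb_nonneg (by norm_num) ?_
      have : 0 ≤ 1 / sys.σID ^ 2 * t * ∑ i, ‖(sys.HID *ᵥ v) i‖ ^ 2 := by positivity
      linarith
    linarith
  · obtain ⟨X, hX⟩ := hD.exists_eq_mul_of_ker_le (H := sys.HID) fun v hv => by
      by_contra hne
      have hs : 0 < ∑ i, ‖(sys.HID *ᵥ v) i‖ ^ 2 := by
        obtain ⟨i, hi⟩ := Function.ne_iff.mp hne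
        exact Finset.sum_pos' (fun _ _ => sq_nonneg _)
          ⟨i, Finset.mem_univ i, by have := norm_pos_iff.mpr hi; positivity⟩
      set c := 1 / sys.σID ^ 2 * ∑ i, ‖(sys.HID *ᵥ v) i‖ ^ 2 with hc
      have hc0 : 0 < c := by positivity
      -- At this `t` the rate is `log₂ (1 + 2^(B+1)) > B`.
      have h1 := hB ((2 : ℝ) ^ (B + 1) / c) (by positivity) v
      rw [hv, dotProduct_zero, Complex.zero_re, mul_zero, sub_zero] at h1
      have h2 : 1 / sys.σID ^ 2 * ((2 : ℝ) ^ (B + 1) / c) * ∑ i, ‖(sys.HID *ᵥ v) i‖ ^ 2 =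
          (2 : ℝ) ^ (B + 1) := by
        rw [mul_right_comm, ← hc, mul_div_cancel₀ _ hc0.ne']
      rw [h2, Real.logb_le_iff_le_rpow (by norm_num) (by positivity)] at h1
      have h3 : (2 : ℝ) ^ B ≤ (2 : ℝ) ^ (B + 1) :=
        Real.rpow_le_rpow_of_exponent_le (by norm_num) (by linarith)
      linarith
    rw [hX, conjTranspose_mul, hD.eq]
    rintro _ ⟨w, rfl⟩
    exact ⟨Xᴴ *ᵥ w, by simp [mulVec_mulVec]⟩

/-- Zero duality gap: the separating multipliers have dual value at most `R(S)`, and no dual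
feasible triple goes below `R(S)`. -/
theorem exists_isDualOptimal_of_isOptimal (hα : sys.α ≠ 0) (hL : 0 < sys.L) (hσS : 0 < sys.σS)
    (hσID : 0 < sys.σID) (hΓS : 0 < sys.ΓS) (hSlater : sys.Slater)
    {S : Matrix (Fin M) (Fin M) ℂ} (hS : sys.IsOptimal S) :
    (∃ (lam nu : ℝ) (Z : Matrix (Fin 2) (Fin 2) ℂ), sys.IsDualOptimal lam nu Z) ∧
      ∀ (lam nu : ℝ) (Z : Matrix (Fin 2) (Fin 2) ℂ), sys.IsDualOptimal lam nu Z →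
        ∀ T : Matrix (Fin M) (Fin M) ℂ, T.PosSemidef →
          sys.lagrangian T lam nu Z ≤ sys.rate S := by
  obtain ⟨lam, nu, Z, hlam, hnu, hZ, hle⟩ := exists_lagrange_multipliers hSlater
    (p := sys.rate S) fun T hT => hS.2 ((mem_feasibleSet_iff hα hL hσS hΓS T).mpr hT)
  have hfeas := isDualFeasible_of_bddAbove hσID hlam hnu hZ hle
  have hdual : sys.dualFun lam nu Z ≤ (sys.rate S : EReal) :=
    iSup_le fun T => EReal.coe_le_coe_iff.mpr (hle T.1 T.2)
  refine ⟨⟨lam, nu, Z, hfeas, fun lam' nu' Z' h' => ?_⟩, fun lam' nu' Z' h' T hT => ?_⟩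
  · refine hdual.trans (le_trans ?_
      (le_iSup (fun T : {S : Matrix (Fin M) (Fin M) ℂ // S.PosSemidef} =>
        ((sys.lagrangian T.1 lam' nu' Z' : ℝ) : EReal)) ⟨S, hS.1.1⟩))
    exact EReal.coe_le_coe_iff.mpr (rate_le_lagrangian
      ((mem_feasibleSet_iff hα hL hσS hΓS S).mp hS.1) h'.lam_nonneg h'.nu_nonneg h'.Z_posSemidef)
  · refine EReal.coe_le_coe_iff.mp (le_trans ?_ ((h'.2 lam nu Z hfeas).trans hdual))
    exact le_iSup (fun T : {S : Matrix (Fin M) (Fin M) ℂ // S.PosSemidef} =>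
        ((sys.lagrangian T.1 lam' nu' Z' : ℝ) : EReal)) ⟨T, hT⟩

end MultiFunMIMO.SystemModel
end

/-! ### Water filling and its uniqueness. -/

noncomputable section
namespace MultiFunMIMO

theorem waterFilling_nonneg {r : ℕ} (σID : ℝ) (rt : ℕ) (s : Fin r → ℝ) (k : Fin r) :
    0 ≤ waterFilling σID rt s k := by
  unfold waterFilling
  split_ifs
  · exact le_max_right _ _
  · exact le_rfl

/-- The scalar optimality condition of water filling: the slope of `x ↦ log₂ (1 + s² x / σ²) - x`
at the water-filling power. -/
theorem waterFilling_slope_mul_le {r : ℕ} {σID : ℝ} (hσ : 0 < σID) {rt : ℕ} {s : Fin r → ℝ}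
    (hpos : ∀ k : Fin r, (k : ℕ) < rt → 0 < s k) (k : Fin r) {x : ℝ} (hx : 0 ≤ x) (hk : k < rt) :
    1 / σID ^ 2 * (s k ^ 2 / (1 + 1 / σID ^ 2 * (waterFilling σID rt s k * s k ^ 2))) /
      Real.log 2 * (x - waterFilling σID rt s k) ≤ x - waterFilling σID rt s k := by
  have hs := hpos k hk
  have hlog : 0 < Real.log 2 := Real.log_pos (by norm_num)
  rw [waterFilling, if_pos hk]
  rcases le_or_gt (1 / Real.log 2 - σID ^ 2 / s k ^ 2) 0 with h | h
  -- Channel off: the power is `0` and the slope there is at most `1`. In the other case the channel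
  -- is on and the slope equals `1`.
  · rw [max_eq_right h]
    refine mul_le_of_le_one_left (by linarith) ?_
    rw [sub_nonpos, div_le_div_iff₀ hlog (by positivity)] at h
    simp only [zero_mul, mul_zero, add_zero, div_one]
    rw [div_le_one hlog, one_div_mul_eq_div, div_le_iff₀ (by positivity)]
    linarith
  · rw [max_eq_left h.le]
    refine le_of_eq ?_
    have h1 : 1 + 1 / σID ^ 2 * ((1 / Real.log 2 - σID ^ 2 / s k ^ 2) * s k ^ 2) =
        s k ^ 2 / (σID ^ 2 * Real.log 2) := by
      field_simp
      ring
    rw [h1]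
    field_simp

/-- The water-filling power allocation is the unique maximizer of
`log₂ det (I + σ⁻² G X Gᴴ) - tr X` over `X ⪰ 0`. -/
theorem waterFilling_isMax {N r : ℕ} {σID : ℝ} (hσ : 0 < σID) {rt : ℕ} {s : Fin r → ℝ}
    (hpos : ∀ k : Fin r, (k : ℕ) < rt → 0 < s k) (hzero : ∀ k : Fin r, rt ≤ (k : ℕ) → s k = 0)
    {G : Matrix (Fin N) (Fin r) ℂ} (hG : Gᴴ * G = diagonal fun k => ((s k ^ 2 : ℝ) : ℂ))
    {X P : Matrix (Fin r) (Fin r) ℂ} (hX : X.PosSemidef)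
    (hP : P = diagonal fun k => (waterFilling σID rt s k : ℂ))
    (hle : Real.log (1 + ((1 / σID ^ 2 : ℝ) : ℂ) • (G * P * Gᴴ)).det.re / Real.log 2 - P.trace.re ≤
      Real.log (1 + ((1 / σID ^ 2 : ℝ) : ℂ) • (G * X * Gᴴ)).det.re / Real.log 2 - X.trace.re) :
    X = P := by
  set p := waterFilling σID rt s with hp
  set c : ℝ := 1 / σID ^ 2 with hc
  have hc0 : 0 < c := by positivity
  have hp0 : ∀ k, 0 ≤ p k := waterFilling_nonneg σID rt s
  have hlog : 0 < Real.log 2 := Real.log_pos (by norm_num)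
  have hPpsd : P.PosSemidef := by
    rw [hP, posSemidef_diagonal_iff]
    exact fun k => Complex.zero_le_real.mpr (hp0 k)
  have hW {Y : Matrix (Fin r) (Fin r) ℂ} (hY : Y.PosSemidef) :
      (1 + (c : ℂ) • (G * Y * Gᴴ)).PosDef :=
    PosDef.one.add_posSemidef ((hY.mul_mul_conjTranspose_same _).smul
      (Complex.zero_le_real.mpr hc0.le))
  obtain ⟨htan, heq⟩ := (hW hPpsd).log_det_re_le_tangent (hW hX)
  set W₀ := 1 + (c : ℂ) • (G * P * Gᴴ) with hW₀
  have hWu : IsUnit W₀.det := (Matrix.isUnit_iff_isUnit_det _).mp (hW hPpsd).isUnit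
  have hdiff : 1 + (c : ℂ) • (G * X * Gᴴ) - W₀ = (c : ℂ) • (G * (X - P) * Gᴴ) := by
    rw [hW₀, add_sub_add_left_eq_sub, ← smul_sub, Matrix.mul_sub, Matrix.sub_mul]
  set q : Fin r → ℂ := fun k => ((1 + c * (p k * s k ^ 2) : ℝ) : ℂ) with hq
  have hq0 (k) : q k ≠ 0 := by
    have : 0 < 1 + c * (p k * s k ^ 2) := by have := hp0 k; positivity
    exact Complex.ofReal_ne_zero.mpr this.ne'
  -- Push-through identity: `W₀ G = G (1 + c P GᴴG)` with a diagonal right factor, so `W₀⁻¹ G` is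
  -- explicit.
  have hWG : W₀ * G = G * diagonal q := by
    have : diagonal q = 1 + (c : ℂ) • (P * (Gᴴ * G)) := by
      rw [hG, hP, diagonal_mul_diagonal]
      ext i j
      rcases eq_or_ne i j with rfl | hij
      · simp [hq]
      · simp [hij]
    rw [this, hW₀]
    simp only [Matrix.add_mul, Matrix.mul_add, Matrix.one_mul, Matrix.mul_one, Matrix.smul_mul,
      Matrix.mul_smul, Matrix.mul_assoc]
  have hWinv : W₀⁻¹ * G = G * diagonal fun k => (q k)⁻¹ := by
    have hqq : diagonal q * diagonal (fun k => (q k)⁻¹) = 1 := by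
      rw [diagonal_mul_diagonal, ← diagonal_one]
      congr 1
      funext k
      exact mul_inv_cancel₀ (hq0 k)
    calc W₀⁻¹ * G = W₀⁻¹ * (G * diagonal q) * diagonal (fun k => (q k)⁻¹) := by
          rw [Matrix.mul_assoc, Matrix.mul_assoc, hqq, Matrix.mul_one]
      _ = _ := by rw [← hWG, ← Matrix.mul_assoc, nonsing_inv_mul _ hWu, Matrix.one_mul]
  set w : Fin r → ℝ := fun k => c * (s k ^ 2 / (1 + c * (p k * s k ^ 2))) with hw
  have hPk (k) : P k k = (p k : ℂ) := by rw [hP, diagonal_apply_eq]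
  have htr : (W₀⁻¹ * (1 + (c : ℂ) • (G * X * Gᴴ) - W₀)).trace.re =
      ∑ k, w k * ((X k k).re - p k) := by
    have h1 : (W₀⁻¹ * (G * (X - P) * Gᴴ)).trace =
        (diagonal (fun k => ((s k ^ 2 : ℝ) : ℂ) * (q k)⁻¹) * (X - P)).trace := by
      rw [← Matrix.mul_assoc, ← Matrix.mul_assoc, hWinv, trace_mul_comm,
        ← diagonal_mul_diagonal, ← hG]
      simp only [Matrix.mul_assoc]
    rw [hdiff, Matrix.mul_smul, trace_smul, h1, smul_eq_mul, Complex.re_ofReal_mul, trace,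
      Complex.re_sum, Finset.mul_sum]
    refine Finset.sum_congr rfl fun k _ => ?_
    have h2 : ((s k ^ 2 : ℝ) : ℂ) * (q k)⁻¹ =
        ((s k ^ 2 / (1 + c * (p k * s k ^ 2)) : ℝ) : ℂ) := by
      rw [hq, div_eq_mul_inv]
      push_cast
      rfl
    rw [diag_apply, diagonal_mul, h2, Complex.re_ofReal_mul, Matrix.sub_apply, hPk, Complex.sub_re,
      Complex.ofReal_re, hw, mul_assoc]
  have hXk (k) : 0 ≤ (X k k).re := (Complex.nonneg_iff.mp hX.diag_nonneg).1
  have hpk (k : Fin r) (hk : rt ≤ (k : ℕ)) : p k = 0 := by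
    rw [hp, waterFilling, if_neg (by omega)]
  have hwk (k : Fin r) (hk : rt ≤ (k : ℕ)) : w k = 0 := by simp [hw, hzero k hk]
  have hterm : ∀ k ∈ Finset.univ, w k / Real.log 2 * ((X k k).re - p k) ≤ (X k k).re - p k := by
    intro k _
    rcases lt_or_ge (k : ℕ) rt with hk | hk
    · exact waterFilling_slope_mul_le hσ hpos k (hXk k) hk
    · rw [hwk k hk, hpk k hk]
      simpa using hXk k
  have hsum := Finset.sum_le_sum hterm
  have hPX : X.trace.re - P.trace.re = ∑ k, ((X k k).re - p k) := by
    simp only [trace, Complex.re_sum, ← Finset.sum_sub_distrib, diag_apply, hPk, Complex.ofReal_re]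
  have hsum' : ∑ k, w k / Real.log 2 * ((X k k).re - p k) =
      (∑ k, w k * ((X k k).re - p k)) / Real.log 2 := by
    rw [Finset.sum_div]
    exact Finset.sum_congr rfl fun k _ => by ring
  rw [htr] at htan heq
  have htan' := div_le_div_of_nonneg_right htan hlog.le
  rw [add_div] at htan'
  -- `hle` closes the chain of inequalities, so the tangent inequality and every scalar inequality
  -- in `hterm` are equalities.
  have hWX : 1 + (c : ℂ) • (G * X * Gᴴ) = W₀ := by
    refine heq (le_antisymm htan ?_)
    rw [← div_le_div_iff_of_pos_right hlog, add_div]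
    linarith
  have hdiag : ∀ k, w k / Real.log 2 * ((X k k).re - p k) = (X k k).re - p k := by
    refine fun k => (Finset.sum_eq_sum_iff_of_le hterm).mp (le_antisymm hsum ?_) k
      (Finset.mem_univ k)
    linarith
  -- Where the gain is zero only the trace cost remains: the diagonal entry vanishes, and
  -- semidefiniteness kills the row.
  have hz : ∀ k : Fin r, rt ≤ (k : ℕ) → ∀ l, X k l = 0 := by
    intro k hk
    refine hX.eq_zero_of_diag_eq_zero ?_
    have h1 := hdiag k
    rw [hwk k hk, hpk k hk, zero_div, zero_mul] at h1
    refine Complex.ext ?_ (Complex.nonneg_iff.mp hX.diag_nonneg).2.symm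
    rw [Complex.zero_re]
    linarith
  -- This determines `X` on the block of positive singular values.
  have hblock : diagonal (fun k => ((s k ^ 2 : ℝ) : ℂ)) * (X - P) *
      diagonal (fun k => ((s k ^ 2 : ℝ) : ℂ)) = 0 := by
    rw [hWX, sub_self] at hdiff
    have h1 : G * (X - P) * Gᴴ = 0 :=
      (smul_eq_zero.mp hdiff.symm).resolve_left (Complex.ofReal_ne_zero.mpr hc0.ne')
    rw [← hG]
    calc Gᴴ * G * (X - P) * (Gᴴ * G) = Gᴴ * (G * (X - P) * Gᴴ) * G := by
          simp only [Matrix.mul_assoc]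
      _ = 0 := by rw [h1, Matrix.mul_zero, Matrix.zero_mul]
  ext k l
  rcases lt_or_ge (k : ℕ) rt with hk | hk
  · rcases lt_or_ge (l : ℕ) rt with hl | hl
    · have h1 := congrFun (congrFun hblock k) l
      rw [mul_diagonal, diagonal_mul, Matrix.zero_apply, Matrix.sub_apply] at h1
      have hsk := (hpos k hk).ne'
      have hsl := (hpos l hl).ne'
      simpa [hsk, hsl, sub_eq_zero] using h1
    · have hkl : k ≠ l := by rintro rfl; omega
      rw [← hX.1.apply, hz l hl, hP, diagonal_apply_ne _ hkl, star_zero]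
  · rw [hz k hk, hP]
    rcases eq_or_ne k l with rfl | hkl
    · rw [diagonal_apply_eq, hpk k hk, Complex.ofReal_zero]
    · rw [diagonal_apply_ne _ hkl]

theorem IsSVD.gram_mul {N r : ℕ} {G : Matrix (Fin N) (Fin r) ℂ} {rt : ℕ}
    {U : Matrix (Fin N) (Fin N) ℂ} {s : Fin r → ℝ} {V : Matrix (Fin r) (Fin r) ℂ}
    (h : IsSVD G rt U s V) : (G * V)ᴴ * (G * V) = diagonal fun k => ((s k ^ 2 : ℝ) : ℂ) := by
  have hU : Uᴴ * U = 1 := mem_unitaryGroup_iff'.mp h.U_mem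
  have hV : Vᴴ * V = 1 := mem_unitaryGroup_iff'.mp h.V_mem
  have hN : rt ≤ N := by
    rw [← h.rank_eq]
    simpa using G.rank_le_height
  have hGV : G * V = U * rectDiagonal N s := by
    rw [h.eq, Matrix.mul_assoc, hV, Matrix.mul_one]
  have : (G * V)ᴴ * (G * V) = (rectDiagonal N s)ᴴ * rectDiagonal N s := by
    rw [hGV, conjTranspose_mul, Matrix.mul_assoc, ← Matrix.mul_assoc _ U, hU, Matrix.one_mul]
  rw [this]
  ext k l
  rw [mul_apply]
  simp only [conjTranspose_apply, rectDiagonal, of_apply]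
  rcases lt_or_ge (k : ℕ) N with hk | hk
  · rw [Finset.sum_eq_single ⟨k, hk⟩ (fun i _ hi => by
      rw [if_neg fun h' => hi (Fin.ext h'), star_zero, zero_mul]) (by simp)]
    rcases eq_or_ne k l with rfl | hkl
    · simp [pow_two]
    · have : (k : ℕ) ≠ l := fun h' => hkl (Fin.ext h')
      simp [hkl, this]
  -- If `r > N`, the columns beyond `N` have no diagonal slot; `rt ≤ N` makes their `s k` zero.
  · have hs : s k = 0 := h.eq_zero k (hN.trans hk)
    rw [Finset.sum_eq_zero fun i _ => by simp [hs]]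
    rcases eq_or_ne k l with rfl | hkl
    · simp [hs]
    · simp [hkl]

/-! ### Eigenvalue decomposition and whitening. -/

section EVD

variable {M r : ℕ} {Q₁ : Matrix (Fin M) (Fin r) ℂ} {Q₀ : Matrix (Fin M) (Fin (M - r)) ℂ}

theorem joinCols_conjTranspose_mul (S : Matrix (Fin M) (Fin M) ℂ) :
    (joinCols Q₁ Q₀)ᴴ * S * joinCols Q₁ Q₀ =
      fromBlocks (Q₁ᴴ * S * Q₁) (Q₁ᴴ * S * Q₀) (Q₀ᴴ * S * Q₁) (Q₀ᴴ * S * Q₀) := by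
  rw [joinCols, conjTranspose_fromCols_eq_fromRows_conjTranspose, fromRows_mul,
    fromRows_mul_fromCols]

variable {D : Matrix (Fin M) (Fin M) ℂ} {σ : Fin r → ℝ}

theorem IsEVD.orthonormal_blocks (h : IsEVD D r Q₁ Q₀ σ) :
    Q₁ᴴ * Q₁ = 1 ∧ Q₁ᴴ * Q₀ = 0 ∧ Q₀ᴴ * Q₁ = 0 ∧ Q₀ᴴ * Q₀ = 1 := by
  have := joinCols_conjTranspose_mul (Q₁ := Q₁) (Q₀ := Q₀) 1
  simp only [Matrix.mul_one] at this
  rw [h.orthonormal, ← fromBlocks_one, fromBlocks_inj] at this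
  exact ⟨this.1.symm, this.2.1.symm, this.2.2.1.symm, this.2.2.2.symm⟩

theorem IsEVD.complete_blocks (h : IsEVD D r Q₁ Q₀ σ) : Q₁ * Q₁ᴴ + Q₀ * Q₀ᴴ = 1 := by
  rw [← h.complete, joinCols, conjTranspose_fromCols_eq_fromRows_conjTranspose,
    fromCols_mul_fromRows]

theorem IsEVD.eq_compact (h : IsEVD D r Q₁ Q₀ σ) :
    D = Q₁ * diagonal (fun k => (σ k : ℂ)) * Q₁ᴴ := by
  conv_lhs => rw [h.eq]
  rw [joinCols, conjTranspose_fromCols_eq_fromRows_conjTranspose, fromCols_mul_fromBlocks,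
    fromCols_mul_fromRows]
  simp

theorem IsEVD.pos (h : IsEVD D r Q₁ Q₀ σ) (hD : D.PosSemidef) (k : Fin r) : 0 < σ k := by
  have h1 := hD.conjTranspose_mul_mul_same Q₁
  have h2 : Q₁ᴴ * D * Q₁ = diagonal (fun k => (σ k : ℂ)) := by
    calc Q₁ᴴ * D * Q₁ = (Q₁ᴴ * Q₁) * diagonal (fun k => (σ k : ℂ)) * (Q₁ᴴ * Q₁) := by
          rw [h.eq_compact]; simp only [Matrix.mul_assoc]
      _ = _ := by rw [h.orthonormal_blocks.1, Matrix.one_mul, Matrix.mul_one]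
  rw [h2, posSemidef_diagonal_iff] at h1
  exact (Complex.zero_le_real.mp (h1 k)).lt_of_ne' (h.ne_zero k)

theorem IsEVD.assemble_eq (h : IsEVD D r Q₁ Q₀ σ) {S : Matrix (Fin M) (Fin M) ℂ}
    (hS : S.IsHermitian) :
    assemble Q₁ Q₀ (Q₁ᴴ * S * Q₁) (Q₁ᴴ * S * Q₀) (Q₀ᴴ * S * Q₀) = S := by
  have h1 : (Q₁ᴴ * S * Q₀)ᴴ = Q₀ᴴ * S * Q₁ := by
    rw [conjTranspose_mul, conjTranspose_mul, conjTranspose_conjTranspose, hS.eq, Matrix.mul_assoc]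
  rw [assemble, h1, ← joinCols_conjTranspose_mul]
  calc _ = (joinCols Q₁ Q₀ * (joinCols Q₁ Q₀)ᴴ) * S *
        (joinCols Q₁ Q₀ * (joinCols Q₁ Q₀)ᴴ) := by simp only [Matrix.mul_assoc]
    _ = S := by rw [h.complete, Matrix.one_mul, Matrix.mul_one]

theorem IsEVD.compress_assemble (h : IsEVD D r Q₁ Q₀ σ) (S₁₁ : Matrix (Fin r) (Fin r) ℂ)
    (S₁₀ : Matrix (Fin r) (Fin (M - r)) ℂ) (S₀₀ : Matrix (Fin (M - r)) (Fin (M - r)) ℂ) :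
    Q₁ᴴ * assemble Q₁ Q₀ S₁₁ S₁₀ S₀₀ * Q₁ = S₁₁ := by
  have h1 := joinCols_conjTranspose_mul (Q₁ := Q₁) (Q₀ := Q₀) (assemble Q₁ Q₀ S₁₁ S₁₀ S₀₀)
  have h2 : (joinCols Q₁ Q₀)ᴴ * assemble Q₁ Q₀ S₁₁ S₁₀ S₀₀ * joinCols Q₁ Q₀ =
      fromBlocks S₁₁ S₁₀ S₁₀ᴴ S₀₀ := by
    calc _ = ((joinCols Q₁ Q₀)ᴴ * joinCols Q₁ Q₀) * fromBlocks S₁₁ S₁₀ S₁₀ᴴ S₀₀ *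
          ((joinCols Q₁ Q₀)ᴴ * joinCols Q₁ Q₀) := by rw [assemble]; simp only [Matrix.mul_assoc]
      _ = _ := by rw [h.orthonormal, Matrix.one_mul, Matrix.mul_one]
  rw [h2, fromBlocks_inj] at h1
  exact h1.1.symm

/-- A matrix whose adjoint has range inside that of `D` vanishes on the kernel part of an
eigenvalue decomposition of `D`. -/
theorem IsEVD.mul_eq_zero_of_range_le (h : IsEVD D r Q₁ Q₀ σ) (hD : D.IsHermitian) {N : ℕ}
    {H : Matrix (Fin N) (Fin M) ℂ}
    (hle : LinearMap.range Hᴴ.mulVecLin ≤ LinearMap.range D.mulVecLin) : H * Q₀ = 0 := by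
  have hDQ : D * Q₀ = 0 := by
    rw [h.eq_compact, Matrix.mul_assoc, h.orthonormal_blocks.2.1, Matrix.mul_zero]
  have hQD : Q₀ᴴ * D = 0 := by
    rw [← conjTranspose_eq_zero, conjTranspose_mul, conjTranspose_conjTranspose, hD.eq, hDQ]
  rw [← conjTranspose_eq_zero, conjTranspose_mul]
  refine ext_of_mulVec_single fun j => ?_
  obtain ⟨x, hx⟩ := hle (LinearMap.mem_range_self _ (Pi.single j 1))
  simp only [mulVecLin_apply] at hx
  rw [← mulVec_mulVec, ← hx, mulVec_mulVec, hQD, zero_mulVec, zero_mulVec]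

end EVD

theorem invSqrtDiag_mul {r : ℕ} {σ : Fin r → ℝ} (hσ : ∀ k, 0 < σ k) :
    invSqrtDiag σ * diagonal (fun k => ((Real.sqrt (σ k) : ℝ) : ℂ)) = 1 := by
  rw [invSqrtDiag, diagonal_mul_diagonal, ← diagonal_one]
  congr 1
  funext k
  rw [← Complex.ofReal_mul, inv_mul_cancel₀ (Real.sqrt_pos.mpr (hσ k)).ne', Complex.ofReal_one]

/-- The whitening transformation `T = Vᴴ Σ^{1/2} Q₁ᴴ`, which turns the Lagrangian maximization
into the water-filling problem. -/
theorem exists_whitening {M r N : ℕ} {D : Matrix (Fin M) (Fin M) ℂ} {Q₁ : Matrix (Fin M) (Fin r) ℂ}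
    {Q₀ : Matrix (Fin M) (Fin (M - r)) ℂ} {σ : Fin r → ℝ} (h : IsEVD D r Q₁ Q₀ σ)
    (hD : D.PosSemidef) {H : Matrix (Fin N) (Fin M) ℂ} (hHQ : H * Q₀ = 0)
    {V : Matrix (Fin r) (Fin r) ℂ} (hV : V ∈ unitaryGroup (Fin r) ℂ) :
    ∃ T : Matrix (Fin r) (Fin M) ℂ, H = H * Q₁ * invSqrtDiag σ * V * T ∧ D = Tᴴ * T ∧
      ∀ (S : Matrix (Fin M) (Fin M) ℂ) (P : Matrix (Fin r) (Fin r) ℂ), T * S * Tᴴ = P ↔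
        Q₁ᴴ * S * Q₁ = invSqrtDiag σ * V * P * Vᴴ * invSqrtDiag σ := by
  have hVV : V * Vᴴ = 1 := mem_unitaryGroup_iff.mp hV
  have hVV' : Vᴴ * V = 1 := mem_unitaryGroup_iff'.mp hV
  have hσ := h.pos hD
  set R : Matrix (Fin r) (Fin r) ℂ := diagonal fun k => ((Real.sqrt (σ k) : ℝ) : ℂ) with hR
  have hRR : invSqrtDiag σ * R = 1 := invSqrtDiag_mul hσ
  have hRR' : R * invSqrtDiag σ = 1 := mul_eq_one_comm.mp hRR
  have hRH : Rᴴ = R := by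
    rw [hR, diagonal_conjTranspose]
    congr 1
    funext k
    simp
  have hR2 : R * R = diagonal fun k => (σ k : ℂ) := by
    rw [hR, diagonal_mul_diagonal]
    congr 1
    funext k
    rw [← Complex.ofReal_mul, Real.mul_self_sqrt (hσ k).le]
  have hT : (Vᴴ * R * Q₁ᴴ)ᴴ = Q₁ * R * V := by
    simp only [conjTranspose_mul, conjTranspose_conjTranspose, hRH, Matrix.mul_assoc]
  refine ⟨Vᴴ * R * Q₁ᴴ, ?_, ?_, fun S P => ?_⟩
  · calc H = H * (Q₁ * Q₁ᴴ + Q₀ * Q₀ᴴ) := by rw [h.complete_blocks, Matrix.mul_one]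
      _ = H * Q₁ * Q₁ᴴ := by
        rw [Matrix.mul_add, ← Matrix.mul_assoc, ← Matrix.mul_assoc, hHQ, Matrix.zero_mul, add_zero]
      _ = H * Q₁ * (invSqrtDiag σ * (V * Vᴴ) * R) * Q₁ᴴ := by
        rw [hVV, Matrix.mul_one, hRR, Matrix.mul_one]
      _ = _ := by simp only [Matrix.mul_assoc]
  · rw [hT]
    calc D = Q₁ * (R * (V * Vᴴ) * R) * Q₁ᴴ := by
          rw [hVV, Matrix.mul_one, hR2, ← h.eq_compact]
      _ = _ := by simp only [Matrix.mul_assoc]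
  · rw [hT]
    constructor
    · rintro rfl
      symm
      calc invSqrtDiag σ * V * (Vᴴ * R * Q₁ᴴ * S * (Q₁ * R * V)) * Vᴴ * invSqrtDiag σ
          = invSqrtDiag σ * (V * Vᴴ) * R * (Q₁ᴴ * S * Q₁) *
              (R * (V * Vᴴ) * invSqrtDiag σ) := by simp only [Matrix.mul_assoc]
        _ = _ := by
          rw [hVV, Matrix.mul_one, Matrix.mul_one, hRR, hRR', Matrix.one_mul, Matrix.mul_one]
    · intro hS
      calc Vᴴ * R * Q₁ᴴ * S * (Q₁ * R * V) = Vᴴ * R * (Q₁ᴴ * S * Q₁) * (R * V) := by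
            simp only [Matrix.mul_assoc]
        _ = Vᴴ * (R * invSqrtDiag σ) * V * P * Vᴴ * (invSqrtDiag σ * R) * V := by
            rw [hS]; simp only [Matrix.mul_assoc]
        _ = P := by
          rw [hRR, hRR', Matrix.mul_one, Matrix.mul_one, hVV', Matrix.one_mul, Matrix.mul_assoc,
            hVV', Matrix.mul_one]

/-- The compression to the range of `D` of a maximizer of the Lagrangian over `S ⪰ 0` is the
water-filling matrix, and the rate only depends on this compression. -/
theorem SystemModel.compression_of_lagrangian_max {M NS NEH NID : ℕ}
    {sys : SystemModel M NS NEH NID} (hσID : 0 < sys.σID) {lam nu : ℝ}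
    {Z : Matrix (Fin 2) (Fin 2) ℂ} (hfeas : sys.IsDualFeasible lam nu Z) {r : ℕ}
    {Q₁ : Matrix (Fin M) (Fin r) ℂ} {Q₀ : Matrix (Fin M) (Fin (M - r)) ℂ} {σ : Fin r → ℝ}
    (hE : IsEVD (sys.D lam nu Z) r Q₁ Q₀ σ) {rt : ℕ} {U : Matrix (Fin NID) (Fin NID) ℂ}
    {s : Fin r → ℝ} {V : Matrix (Fin r) (Fin r) ℂ}
    (hsvd : IsSVD (sys.HID * Q₁ * invSqrtDiag σ) rt U s V) :
    (∀ S : Matrix (Fin M) (Fin M) ℂ, S.PosSemidef →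
      (∀ T : Matrix (Fin M) (Fin M) ℂ, T.PosSemidef →
        sys.lagrangian T lam nu Z ≤ sys.lagrangian S lam nu Z) →
      Q₁ᴴ * S * Q₁ = optS11 sys.σID σ rt s V) ∧
    ∀ S T : Matrix (Fin M) (Fin M) ℂ, Q₁ᴴ * S * Q₁ = optS11 sys.σID σ rt s V →
      Q₁ᴴ * T * Q₁ = optS11 sys.σID σ rt s V → sys.rate S = sys.rate T := by
  set P : Matrix (Fin r) (Fin r) ℂ :=
    diagonal fun k => (waterFilling sys.σID rt s k : ℂ) with hP
  obtain ⟨T, hH, hDT, hiff⟩ := exists_whitening hE hfeas.D_posSemidef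
    (hE.mul_eq_zero_of_range_le hfeas.D_posSemidef.1 hfeas.range_le) hsvd.V_mem
  set G := sys.HID * Q₁ * invSqrtDiag σ * V with hG
  have hHS (S : Matrix (Fin M) (Fin M) ℂ) :
      sys.HID * S * sys.HIDᴴ = G * (T * S * Tᴴ) * Gᴴ := by
    conv_lhs => rw [hH, conjTranspose_mul]
    simp only [Matrix.mul_assoc]
  have hrate (S : Matrix (Fin M) (Fin M) ℂ) : sys.rate S =
      Real.log (1 + ((1 / sys.σID ^ 2 : ℝ) : ℂ) • (G * (T * S * Tᴴ) * Gᴴ)).det.re /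
        Real.log 2 := by
    rw [rate_eq, rateMatrix, hHS]
  have htrace (S : Matrix (Fin M) (Fin M) ℂ) :
      (sys.D lam nu Z * S).trace.re = (T * S * Tᴴ).trace.re := by
    rw [hDT, Matrix.mul_assoc, trace_mul_comm]
  refine ⟨fun S hS hmax => ?_, fun S S' hS hS' => ?_⟩
  -- The comparison point: the completion with zero kernel blocks, for which `T S₀ Tᴴ = P`. It need
  -- not be feasible for the primal problem.
  · set S₀ := Q₁ * optS11 sys.σID σ rt s V * Q₁ᴴ with hS₀
    have hPpsd : P.PosSemidef := by
      rw [hP, posSemidef_diagonal_iff]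
      exact fun k => Complex.zero_le_real.mpr (waterFilling_nonneg _ _ _ k)
    have hopt : (optS11 sys.σID σ rt s V).PosSemidef := by
      have h1 : optS11 sys.σID σ rt s V = (invSqrtDiag σ * V) * P * (invSqrtDiag σ * V)ᴴ := by
        have : (invSqrtDiag σ)ᴴ = invSqrtDiag σ := by
          rw [invSqrtDiag, diagonal_conjTranspose]
          congr 1
          funext k
          simp
        rw [conjTranspose_mul, this, optS11, ← Matrix.mul_assoc]
      rw [h1]
      exact hPpsd.mul_mul_conjTranspose_same _
    have hTS₀ : T * S₀ * Tᴴ = P := by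
      rw [hiff]
      calc Q₁ᴴ * S₀ * Q₁ = (Q₁ᴴ * Q₁) * optS11 sys.σID σ rt s V * (Q₁ᴴ * Q₁) := by
            rw [hS₀]; simp only [Matrix.mul_assoc]
        _ = _ := by rw [hE.orthonormal_blocks.1, Matrix.one_mul, Matrix.mul_one]; rfl
    refine (hiff S P).mp (waterFilling_isMax hσID hsvd.pos hsvd.eq_zero hsvd.gram_mul
      (hS.mul_mul_conjTranspose_same T) hP ?_)
    have h1 := hmax S₀ (hopt.mul_mul_conjTranspose_same Q₁)
    unfold lagrangian at h1
    rw [hrate, hrate, htrace, htrace, hTS₀] at h1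
    linarith
  · rw [hrate, hrate, (hiff S P).mpr hS, (hiff S' P).mpr hS']

end MultiFunMIMO
end

/-! ### The optimal solutions of the rate maximization problem. -/

theorem proposition1 {M NS NEH NID : ℕ} (sys : MultiFunMIMO.SystemModel M NS NEH NID)
    (hα : sys.α ≠ 0) (hL : 0 < sys.L) (hσS : 0 < sys.σS) (hσID : 0 < sys.σID)
    (hΓS : 0 < sys.ΓS) (hSlater : sys.Slater) :
    (∃ (lam nu : ℝ) (Z : Matrix (Fin 2) (Fin 2) ℂ), sys.IsDualOptimal lam nu Z) ∧
    ∀ (lam nu : ℝ) (Z : Matrix (Fin 2) (Fin 2) ℂ), sys.IsDualOptimal lam nu Z →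
    ∀ (r : ℕ) (Q₁ : Matrix (Fin M) (Fin r) ℂ) (Q₀ : Matrix (Fin M) (Fin (M - r)) ℂ)
      (σ : Fin r → ℝ), MultiFunMIMO.IsEVD (sys.D lam nu Z) r Q₁ Q₀ σ →
    ∀ (rt : ℕ) (U : Matrix (Fin NID) (Fin NID) ℂ) (s : Fin r → ℝ)
      (V : Matrix (Fin r) (Fin r) ℂ),
      MultiFunMIMO.IsSVD (sys.HID * Q₁ * MultiFunMIMO.invSqrtDiag σ) rt U s V →
    (∃ (S₁₀ : Matrix (Fin r) (Fin (M - r)) ℂ) (S₀₀ : Matrix (Fin (M - r)) (Fin (M - r)) ℂ),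
      sys.SatisfiesConvexConstraints
        (MultiFunMIMO.assemble Q₁ Q₀ (MultiFunMIMO.optS11 sys.σID σ rt s V) S₁₀ S₀₀)) ∧
    ∀ S : Matrix (Fin M) (Fin M) ℂ, sys.IsOptimal S ↔
      ∃ (S₁₀ : Matrix (Fin r) (Fin (M - r)) ℂ) (S₀₀ : Matrix (Fin (M - r)) (Fin (M - r)) ℂ),
        sys.SatisfiesConvexConstraints
          (MultiFunMIMO.assemble Q₁ Q₀ (MultiFunMIMO.optS11 sys.σID σ rt s V) S₁₀ S₀₀) ∧
        S = MultiFunMIMO.assemble Q₁ Q₀ (MultiFunMIMO.optS11 sys.σID σ rt s V) S₁₀ S₀₀ := by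
  have hmem := MultiFunMIMO.SystemModel.mem_feasibleSet_iff (sys := sys) hα hL hσS hΓS
  obtain ⟨S', hS'⟩ := MultiFunMIMO.SystemModel.exists_isOptimal hα hL hσS hΓS hSlater
  refine ⟨(MultiFunMIMO.SystemModel.exists_isDualOptimal_of_isOptimal
    hα hL hσS hσID hΓS hSlater hS').1, ?_⟩
  intro lam nu Z hdual r Q₁ Q₀ σ hE rt U s V hsvd
  obtain ⟨hcomp, hrate⟩ :=
    MultiFunMIMO.SystemModel.compression_of_lagrangian_max hσID hdual.1 hE hsvd
  have hopt {S : Matrix (Fin M) (Fin M) ℂ} (hS : sys.IsOptimal S) :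
      Q₁ᴴ * S * Q₁ = MultiFunMIMO.optS11 sys.σID σ rt s V := by
    refine hcomp S hS.1.1 fun T hT => ?_
    exact ((MultiFunMIMO.SystemModel.exists_isDualOptimal_of_isOptimal
      hα hL hσS hσID hΓS hSlater hS).2 lam nu Z hdual T hT).trans
      (MultiFunMIMO.SystemModel.rate_le_lagrangian ((hmem S).mp hS.1) hdual.1.lam_nonneg
        hdual.1.nu_nonneg hdual.1.Z_posSemidef)
  have hexists {S : Matrix (Fin M) (Fin M) ℂ} (hS : sys.IsOptimal S) :
      ∃ (S₁₀ : Matrix (Fin r) (Fin (M - r)) ℂ) (S₀₀ : Matrix (Fin (M - r)) (Fin (M - r)) ℂ),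
        sys.SatisfiesConvexConstraints
          (MultiFunMIMO.assemble Q₁ Q₀ (MultiFunMIMO.optS11 sys.σID σ rt s V) S₁₀ S₀₀) ∧
        S = MultiFunMIMO.assemble Q₁ Q₀ (MultiFunMIMO.optS11 sys.σID σ rt s V) S₁₀ S₀₀ := by
    have h1 := hE.assemble_eq hS.1.1.1
    rw [hopt hS] at h1
    exact ⟨_, _, by rw [h1]; exact (hmem S).mp hS.1, h1.symm⟩
  refine ⟨?_, fun S => ⟨hexists, ?_⟩⟩
  · obtain ⟨S₁₀, S₀₀, h, -⟩ := hexists hS'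
    exact ⟨S₁₀, S₀₀, h⟩
  · rintro ⟨S₁₀, S₀₀, h, rfl⟩
    refine ⟨(hmem _).mpr h, fun T hT => ?_⟩
    -- The completion and the optimum `S'` share the compressed block, hence the rate.
    rw [Set.mem_ofPred_eq, hrate _ S' (hE.compress_assemble _ _ _) (hopt hS')]
    exact hS'.2 hT
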